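/- Let $K$ be a field of characteristic zero, let $D$ be an integral domain which is a $K$-algebra, and let $L$ be an algebraic closure of the field of fractions of $D$. Let $n,m\in\mathbb N$ with $n\nmid m$ and $m\nmid n$, let $\lambda_0=1,\lambda_1,\dots,\lambda_{m+n-2}\in K$ and let $F_{1-n}\in D$. For a commutative $D$-algebra $D'$ (we use $D'=D$ and $D'=L$), a \emph{solution of $S(n,m,(\lambda_i),F_{1-n})$ over $D'$} is a Laurent series $$C=x+C_{-1}x^{-1}+C_{-2}x^{-2}+\cdots\in D'((x^{-1}))$$ for which there exist $P,Q\in D'[x]$ and $F=F_{1-n}x^{1-n}+F_{-n}x^{-n}+F_{-n-1}x^{-n-1}+\cdots\in D'[[x^{-1}]]$ such that $$P=C^n\qquad\text{and}\qquad Q=\sum_{i=0}^{m+n-2}\lambda_iC^{m-i}+F .$$ The polynomials $P,Q$ are then determined by $C$. Call $C$ \emph{regular} if there are $A,B\in D'[x]$ with $AP'+BQ'=1$. Let $E_1,\dots,E_{m+n-2}\in D[Z_{-1},\dots,Z_{-m-n+2}]$ be the polynomials of the associated standard system: with $Z=x+Z_{-1}x^{-1}+\cdots+Z_{-m-n+2}x^{-m-n+2}$,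 $E_i=(Z^n)_{-i}$ for $1\le i<m$, $E_i=\bigl(\sum_{k=0}^{m+n-2}\lambda_kZ^{m-k}\bigr)_{m-i-1}$ for $m\le i<m+n-2$, and $E_{m+n-2}=\bigl(\sum_{k=0}^{m+n-2}\lambda_kZ^{m-k}\bigr)_{1-n}+F_{1-n}$, where $H_k$ denotes the coefficient of $x^k$ in $H$. Then: 1. $S(n,m,(\lambda_i),F_{1-n})$ has only finitely many regular solutions over $D$, and only finitely many regular solutions over $L$. 2. Suppose that $S(n,m,(\lambda_i),F_{1-n})$ has a regular solution over $D$, and that $F_{1-n}\neq 0$ or every solution over $L$ is regular. Then $S(n,m,(\lambda_i),F_{1-n})$ has only finitely many solutions over $D$ and only finitely many solutions over $L$, and the variety over $L$ defined by $E_1=\dots=E_{m+n-2}=0$ is zero-dimensional, that is, the ring $L[Z_{-1},\dots,Z_{-m-n+2}]/(E_1,\dots,E_{m+n-2})$ has Krull dimension $0$. 3. In particular, let $D=K[y]$ and $F_{1-n}=y$, which is the case of the systems attached to counterexamples to the Jacobian conjecture in dimension two. Then $S(n,m,(\lambda_i),y)$ has only finitely many solutions over an algebraic closure $L$ of $K(y)$,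 and the ring $L[Z_{-1},\dots,Z_{-m-n+2}]/(E_1,\dots,E_{m+n-2})$ has Krull dimension at most $0$ (it may be the zero ring). The dimension is exactly $0$ as soon as the system has a solution over $K[y]$, in particular if the system is attached to a counterexample to the Jacobian conjecture. -/

import Mathlib

open Polynomial

noncomputable section

/-- We model `D((x⁻¹))` by `LaurentSeries D`, the formal variable of `LaurentSeries D` being
`x⁻¹`. Thus the coefficient of `x ^ k` is the coefficient of index `-k`. -/
def xCoeff {D : Type*} [CommRing D] (H : LaurentSeries D) (k : ℤ) : D :=
  HahnSeries.coeff H (-k)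

/-- The monomial `c * x ^ k` of `D((x⁻¹))`. -/
def xMonomial {D : Type*} [CommRing D] (k : ℤ) (c : D) : LaurentSeries D :=
  HahnSeries.single (-k) c

/-- The inclusion of `D[x]` in `D((x⁻¹))`. -/
def polyToLaurent {D : Type*} [CommRing D] : D[X] →+* LaurentSeries D :=
  Polynomial.eval₂RingHom HahnSeries.C (xMonomial 1 1)

/-- `C` has the form `x + C₋₁ x⁻¹ + C₋₂ x⁻² + ⋯`. -/
structure IsNormalized {D : Type*} [CommRing D] (C : LaurentSeries D) : Prop where
  coeff_one : xCoeff C 1 = 1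
  coeff_zero : xCoeff C 0 = 0
  coeff_of_one_lt : ∀ k : ℤ, 1 < k → xCoeff C k = 0

/-- Integral powers in `D((x⁻¹))`. Only used for series that are invertible
(see `IsNormalized.isUnit`). -/
def laurentZPow {D : Type*} [CommRing D] (C : LaurentSeries D) : ℤ → LaurentSeries D
  | Int.ofNat k => C ^ k
  | Int.negSucc k => Ring.inverse C ^ (k + 1)

theorem IsNormalized.isUnit {D : Type*} [CommRing D] {C : LaurentSeries D}
    (h : IsNormalized C) : IsUnit C := by
  rcases subsingleton_or_nontrivial D with hD | hD
  · have : Subsingleton (LaurentSeries D) := ⟨fun a b => by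
      ext k; exact Subsingleton.elim _ _⟩
    exact isUnit_of_subsingleton C
  · have h1 : C.coeff (-1) = 1 := h.coeff_one
    have hC : C ≠ 0 := by
      rintro rfl
      simp at h1
    have hle : C.order ≤ -1 := HahnSeries.order_le_of_coeff_ne_zero (by rw [h1]; exact one_ne_zero)
    have hge : -1 ≤ C.order := by
      rw [HahnSeries.le_order_iff_forall hC]
      intro j hj
      have := h.coeff_of_one_lt (-j) (by omega)
      simpa [xCoeff] using this
    have ho : C.order = -1 := le_antisymm hle hge
    refine HahnSeries.isUnit_of_isUnit_leadingCoeff_AddUnitOrder ?_ ?_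
    · rw [HahnSeries.leadingCoeff_eq, ho, h1]
      exact isUnit_one
    · exact AddGroup.isAddUnit _

/-- `C` is a solution of `S(n, m, (λᵢ), F₁₋ₙ)` in `D((x⁻¹))`, where `F₁₋ₙ = f`, and `(P, Q)` is
the pair of polynomials associated with `C`:
`P = C ^ n` and `Q = ∑_{i=0}^{m+n-2} λᵢ C ^ (m-i) + F` with `F = f x^(1-n) + F₋ₙ x^(-n) + ⋯`. -/
structure IsSolutionWithPair {K D : Type*} [Field K] [CommRing D] [Algebra K D]
    (n m : ℕ) (lam : ℕ → K) (f : D) (C : LaurentSeries D) (P Q : D[X]) : Prop where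
  normalized : IsNormalized C
  eq_pow : polyToLaurent P = C ^ n
  eq_sum : ∃ F : LaurentSeries D,
    (∀ k : ℤ, 1 - (n : ℤ) < k → xCoeff F k = 0) ∧
    xCoeff F (1 - (n : ℤ)) = f ∧
    polyToLaurent Q =
      (∑ i ∈ Finset.range (m + n - 1),
        algebraMap K D (lam i) • laurentZPow C ((m : ℤ) - (i : ℤ))) + F

/-- `C` is a solution of `S(n, m, (λᵢ), f)` in `D((x⁻¹))`. -/
def IsSolution {K D : Type*} [Field K] [CommRing D] [Algebra K D]
    (n m : ℕ) (lam : ℕ → K) (f : D) (C : LaurentSeries D) : Prop :=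
  ∃ P Q : D[X], IsSolutionWithPair n m lam f C P Q

/-- `C` is a solution of `S(n, m, (λᵢ), f)` in `D((x⁻¹))` such that its associated pair `(P, Q)`
satisfies `A P' + B Q' = 1` for some `A, B ∈ D[x]`. -/
def IsRegularSolution {K D : Type*} [Field K] [CommRing D] [Algebra K D]
    (n m : ℕ) (lam : ℕ → K) (f : D) (C : LaurentSeries D) : Prop :=
  ∃ P Q : D[X], IsSolutionWithPair n m lam f C P Q ∧
    ∃ A B : D[X], A * derivative P + B * derivative Q = 1

/-- `x + Z₋₁ x⁻¹ + ⋯ + Z₋N x^(-N)` with indeterminate coefficients; the variable of index `k`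
is `Z₋₍ₖ₊₁₎`. -/
def genericSeries (D : Type*) [CommRing D] (N : ℕ) : LaurentSeries (MvPolynomial (Fin N) D) :=
  xMonomial 1 1 + ∑ k : Fin N, xMonomial (-((k : ℤ) + 1)) (MvPolynomial.X k)

theorem genericSeries_isNormalized (D : Type*) [CommRing D] (N : ℕ) :
    IsNormalized (genericSeries D N) := by
  constructor
  · have : ∀ k : Fin N, (-1 : ℤ) ≠ (k : ℤ) + 1 := fun k => by omega
    simp [genericSeries, xCoeff, xMonomial, this]
  · have : ∀ k : Fin N, (0 : ℤ) ≠ (k : ℤ) + 1 := fun k => by omega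
    simp [genericSeries, xCoeff, xMonomial, this]
  · intro j hj
    have h1 : -j ≠ (-1 : ℤ) := by omega
    have h1' : j ≠ 1 := by omega
    have : ∀ k : Fin N, -j ≠ (k : ℤ) + 1 := fun k => by omega
    simp [genericSeries, xCoeff, xMonomial, h1', this]

/-- The polynomials `E₁, …, E_{m+n-2}` of the standard system of equations associated with
`S(n, m, (λᵢ), f)`; index `i` stands for `E_{i+1}`. Here
`E_i = (Z ^ n)_{-i}` for `1 ≤ i < m`, and
`E_i = (∑ₖ λₖ Z ^ (m-k))_{m-i-1}` for `m ≤ i ≤ m+n-2`, with `f` added when `i = m+n-2`. -/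
def standardSystem {K D : Type*} [Field K] [CommRing D] [Algebra K D]
    (n m : ℕ) (lam : ℕ → K) (f : D) (i : Fin (m + n - 2)) :
    MvPolynomial (Fin (m + n - 2)) D :=
  if (i : ℕ) + 1 < m then
    xCoeff (genericSeries D (m + n - 2) ^ n) (-((i : ℤ) + 1))
  else
    xCoeff (∑ k ∈ Finset.range (m + n - 1),
        (MvPolynomial.C (algebraMap K D (lam k)) : MvPolynomial (Fin (m + n - 2)) D) •
          laurentZPow (genericSeries D (m + n - 2)) ((m : ℤ) - (k : ℤ)))
      ((m : ℤ) - ((i : ℤ) + 1) - 1)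
    + (if (i : ℕ) + 1 = m + n - 2 then MvPolynomial.C f else 0)

/-- The Krull dimension of the affine scheme over `L` cut out by the standard system of equations
associated with `S(n, m, (λᵢ), f)`. -/
def standardSystemDim {K L : Type*} [Field K] [Field L] [Algebra K L]
    (n m : ℕ) (lam : ℕ → K) (f : L) : WithBot ℕ∞ :=
  ringKrullDim (MvPolynomial (Fin (m + n - 2)) L ⧸
    Ideal.span (Set.range (standardSystem n m lam f)))

/-- An algebraic closure of the field of fractions of `D`. -/
abbrev FracClosure (D : Type*) [CommRing D] [IsDomain D] : Type _ :=
  AlgebraicClosure (FractionRing D)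

end

/-! Truncating a solution after `N = m + n - 2` coefficients loses nothing: the discarded tail
changes `C ^ n` only in degrees `≤ -m` and the `λ`-sum only in degrees `≤ -n`, below everything the
equations `E_i` read. Conversely, a zero of the system over a field of characteristic zero gives
back `C` as the `n`-th root of the polynomial part of `Z ^ n`. So solutions over `L` are the points
of the affine variety `E = 0`, and both finiteness and dimension zero follow once the points in
question are shown to be isolated.

Let `p` be a prime of the variety passing through such a point, and `M` the field of fractions of
`L[Z]/p`. The tautological point is a solution `C'` over `M`, with pair `(P, Q)`. It suffices that
every `L`-derivation `δ` of `M` kills `C'`: then `M` has no nonzero `L`-derivation, so it is finite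
over `L`, and `p` is maximal.

The chain rule and a degree count show that the Jacobian `δP * Q' - P' * δQ` vanishes, because `δ`
kills `K` and `f` (`IsSolutionWithPair.jacobian_eq_zero`). Since `deg δP ≤ n - 2 < deg P'`, there
are two ways to deduce `δP = 0`, hence `δC' = 0`.

If the point is regular, nonvanishing of a resultant spreads from the point to the generic point.
Then `P'` and `Q'` are coprime, so `P'` divides `δP`, which is therefore zero.

If `f ≠ 0`, then `M(P, Q) = M(x)`: after a substitution sending `C'` to `x`, the conjugates of `x`
over `M(P)` differ by `x ↦ ζ x`, and the coefficient `f` of `x ^ (1 - n)` in `Q` tells them apart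
(`IsSolutionWithPair.exists_mul_eq`). If `δP ≠ 0`, the field `δ - (δP / P') ∂ₓ` kills `P` and `Q`,
so it stabilizes `M[P, Q]`, and it has a pole of some order `e ≥ 1` along an irreducible `π`. This
forces the `π`-multiplicity of every nonzero element of `M[P, Q]` to be divisible by `e + 1`
(`dvd_multiplicity_of_stable`), which is absurd since `π` is a quotient of two such elements. -/

noncomputable section

/-! ### Degree calculus for Laurent series in `x⁻¹`. -/

section Degree

variable {R S : Type*} [CommRing R] [CommRing S]

theorem laurent_ext {U V : LaurentSeries R} (h : ∀ k, xCoeff U k = xCoeff V k) : U = V := by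
  ext k
  simpa [xCoeff] using h (-k)

@[simp] theorem xCoeff_zero (k : ℤ) : xCoeff (0 : LaurentSeries R) k = 0 := rfl

@[simp] theorem xCoeff_add (U V : LaurentSeries R) (k : ℤ) :
    xCoeff (U + V) k = xCoeff U k + xCoeff V k := rfl

@[simp] theorem xCoeff_sub (U V : LaurentSeries R) (k : ℤ) :
    xCoeff (U - V) k = xCoeff U k - xCoeff V k := rfl

@[simp] theorem xCoeff_smul (r : R) (U : LaurentSeries R) (k : ℤ) :
    xCoeff (r • U) k = r * xCoeff U k := rfl

@[simp] theorem xCoeff_sum {ι : Type*} (s : Finset ι) (U : ι → LaurentSeries R) (k : ℤ) :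
    xCoeff (∑ i ∈ s, U i) k = ∑ i ∈ s, xCoeff (U i) k := by
  simp [xCoeff]

theorem xCoeff_xMonomial (k j : ℤ) (c : R) :
    xCoeff (xMonomial k c) j = if j = k then c else 0 := by
  simp only [xCoeff, xMonomial, HahnSeries.coeff_single, neg_inj]

theorem xCoeff_one (j : ℤ) : xCoeff (1 : LaurentSeries R) j = if j = 0 then 1 else 0 := by
  simp [xCoeff, HahnSeries.coeff_one]

/-- `H` has degree at most `k` in `x`. -/
def HasDegLE (H : LaurentSeries R) (k : ℤ) : Prop := ∀ j, k < j → xCoeff H j = 0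

theorem exists_hasDegLE (H : LaurentSeries R) : ∃ k, HasDegLE H k :=
  ⟨-H.order, fun _ hj => HahnSeries.coeff_eq_zero_of_lt_order (by omega)⟩

namespace HasDegLE

variable {U V : LaurentSeries R} {a b : ℤ}

theorem mono (h : HasDegLE U a) (hab : a ≤ b) : HasDegLE U b :=
  fun j hj => h j (by omega)

theorem zero : HasDegLE (0 : LaurentSeries R) a := fun _ _ => rfl

theorem add (hU : HasDegLE U a) (hV : HasDegLE V a) : HasDegLE (U + V) a := fun j hj => by
  simp [hU j hj, hV j hj]

theorem sub (hU : HasDegLE U a) (hV : HasDegLE V a) : HasDegLE (U - V) a := fun j hj => by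
  simp [hU j hj, hV j hj]

theorem smul (r : R) (hU : HasDegLE U a) : HasDegLE (r • U) a := fun j hj => by
  simp [hU j hj]

theorem sum {ι : Type*} {s : Finset ι} {U : ι → LaurentSeries R}
    (h : ∀ i ∈ s, HasDegLE (U i) a) : HasDegLE (∑ i ∈ s, U i) a := fun j hj => by
  rw [xCoeff_sum]
  exact Finset.sum_eq_zero fun i hi => h i hi j hj

theorem one : HasDegLE (1 : LaurentSeries R) 0 := fun j hj => by
  rw [xCoeff_one, if_neg (by omega)]

theorem xMonomial (k : ℤ) (c : R) : HasDegLE (xMonomial k c) k := fun j hj => by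
  rw [xCoeff_xMonomial, if_neg (by omega)]

theorem mul (hU : HasDegLE U a) (hV : HasDegLE V b) : HasDegLE (U * V) (a + b) := fun j hj => by
  rw [xCoeff, HahnSeries.coeff_mul]
  refine Finset.sum_eq_zero fun p hp => ?_
  rw [Finset.mem_antidiagonal] at hp
  rcases lt_or_ge a (-p.1) with h | h
  · have := hU _ h
    simp only [xCoeff, neg_neg] at this
    simp [this]
  · have := hV (-p.2) (by omega)
    simp only [xCoeff, neg_neg] at this
    simp [this]

theorem xCoeff_mul (hU : HasDegLE U a) (hV : HasDegLE V b) :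
    xCoeff (U * V) (a + b) = xCoeff U a * xCoeff V b := by
  rw [xCoeff, HahnSeries.coeff_mul, Finset.sum_eq_single (-a, -b)]
  · rfl
  · intro p hp hne
    rw [Finset.mem_antidiagonal] at hp
    rcases lt_or_ge a (-p.1) with h | h
    · have := hU _ h
      simp only [xCoeff, neg_neg] at this
      simp [this]
    · have h2 : -p.1 ≠ a := by
        intro h2
        apply hne
        ext <;> simp <;> omega
      have := hV (-p.2) (by omega)
      simp only [xCoeff, neg_neg] at this
      simp [this]
  · intro h
    rw [Finset.mem_antidiagonal] at h
    simp only [HahnSeries.mem_support, not_and_or, not_not] at h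
    rcases h with h | h | h
    · simp [h]
    · simp [h]
    · omega

theorem pow (hU : HasDegLE U a) (k : ℕ) : HasDegLE (U ^ k) (k * a) := by
  induction k with
  | zero => simpa using one
  | succ k ih =>
    rw [pow_succ]
    exact (ih.mul hU).mono (by push_cast; linarith)

theorem xCoeff_pow (hU : HasDegLE U a) (k : ℕ) : xCoeff (U ^ k) (k * a) = xCoeff U a ^ k := by
  induction k with
  | zero => simp [xCoeff_one]
  | succ k ih =>
    rw [pow_succ, pow_succ, ← ih, ← (hU.pow k).xCoeff_mul hU]
    congr 1
    push_cast
    ring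

/-- Division by a series with invertible leading coefficient. -/
theorem of_mul (hU : HasDegLE U a) (hu : IsUnit (xCoeff U a)) (h : HasDegLE (U * V) (a + b)) :
    HasDegLE V b := by
  obtain ⟨d, hd⟩ := exists_hasDegLE V
  -- Lower the bound one degree at a time: while it exceeds `b`, the top coefficient of `V` times a
  -- unit is a coefficient of `U * V` that vanishes.
  have key : ∀ e : ℕ, HasDegLE V (d - e) ∨ HasDegLE V b := by
    intro e
    induction e with
    | zero => left; simpa using hd
    | succ e ih =>
      rcases ih with ih | ih
      · by_cases hb : d - e ≤ b
        · exact Or.inr (ih.mono hb)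
        left
        intro j hj
        rcases eq_or_ne j (d - e) with rfl | hne
        · have h1 := hU.xCoeff_mul ih
          rw [h _ (by omega)] at h1
          exact (hu.mul_right_eq_zero).1 h1.symm
        · exact ih j (by push_cast at hj; omega)
      · exact Or.inr ih
  rcases key (d - b).toNat with h | h
  · exact h.mono (by omega)
  · exact h

end HasDegLE

theorem eq_zero_of_hasDegLE {V : LaurentSeries R} (h : ∀ b, HasDegLE V b) : V = 0 :=
  laurent_ext fun k => h (k - 1) k (by omega)

theorem IsNormalized.hasDegLE {C : LaurentSeries R} (hC : IsNormalized C) : HasDegLE C 1 :=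
  hC.coeff_of_one_lt

theorem IsNormalized.isUnit_xCoeff {C : LaurentSeries R} (hC : IsNormalized C) :
    IsUnit (xCoeff C 1) := by
  rw [hC.coeff_one]; exact isUnit_one

theorem laurentZPow_zero (C : LaurentSeries R) : laurentZPow C 0 = 1 := pow_zero C

theorem IsNormalized.laurentZPow_eq {C : LaurentSeries R} (hC : IsNormalized C) (k : ℤ) :
    laurentZPow C k = ((hC.isUnit.unit ^ k : (LaurentSeries R)ˣ) : LaurentSeries R) := by
  cases k with
  | ofNat k => simp [laurentZPow]
  | negSucc k =>
    rw [laurentZPow, zpow_negSucc, ← inv_pow, Units.val_pow_eq_pow_val, ← Ring.inverse_unit]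
    rfl

theorem IsNormalized.laurentZPow_add_one {C : LaurentSeries R} (hC : IsNormalized C) (k : ℤ) :
    laurentZPow C (k + 1) = C * laurentZPow C k := by
  rw [hC.laurentZPow_eq, hC.laurentZPow_eq, zpow_add_one, mul_comm, Units.val_mul]
  rfl

theorem IsNormalized.hasDegLE_laurentZPow {C : LaurentSeries R} (hC : IsNormalized C) (k : ℤ) :
    HasDegLE (laurentZPow C k) k := by
  induction k with
  | zero => rw [laurentZPow_zero]; exact HasDegLE.one
  | succ k ih =>
    rw [hC.laurentZPow_add_one]
    exact (hC.hasDegLE.mul ih).mono (by omega)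
  | pred k ih =>
    refine hC.hasDegLE.of_mul hC.isUnit_xCoeff ?_
    rw [← hC.laurentZPow_add_one]
    rw [sub_add_cancel]
    exact ih.mono (by omega)

theorem IsNormalized.xCoeff_laurentZPow {C : LaurentSeries R} (hC : IsNormalized C) (k : ℤ) :
    xCoeff (laurentZPow C k) k = 1 := by
  have step : ∀ k, xCoeff (laurentZPow C (k + 1)) (k + 1) = xCoeff (laurentZPow C k) k := by
    intro k
    have h := hC.hasDegLE.xCoeff_mul (hC.hasDegLE_laurentZPow k)
    rwa [← hC.laurentZPow_add_one, hC.coeff_one, one_mul, add_comm 1 k] at h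
  induction k with
  | zero => rw [laurentZPow_zero, xCoeff_one, if_pos rfl]
  | succ k ih => rw [step, ih]
  | pred k ih => rw [← step, sub_add_cancel, ih]

/-- Powers of normalized series which agree up to some degree. -/
theorem IsNormalized.hasDegLE_laurentZPow_sub {C Z : LaurentSeries R} (hC : IsNormalized C)
    (hZ : IsNormalized Z) {s : ℤ} (h : HasDegLE (C - Z) s) (k : ℤ) :
    HasDegLE (laurentZPow C k - laurentZPow Z k) (s + k - 1) := by
  induction k with
  | zero => rw [laurentZPow_zero, laurentZPow_zero, sub_self]; exact HasDegLE.zero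
  | succ k ih =>
    rw [hC.laurentZPow_add_one, hZ.laurentZPow_add_one]
    have e : C * laurentZPow C k - Z * laurentZPow Z k =
      C * (laurentZPow C k - laurentZPow Z k) + (C - Z) * laurentZPow Z k := by ring
    rw [e]
    exact ((hC.hasDegLE.mul ih).mono (by omega)).add
      ((h.mul (hZ.hasDegLE_laurentZPow k)).mono (by omega))
  | pred k ih =>
    refine hC.hasDegLE.of_mul hC.isUnit_xCoeff ?_
    have e : C * (laurentZPow C (-k - 1) - laurentZPow Z (-k - 1)) =
      (laurentZPow C (-k) - laurentZPow Z (-k)) - (C - Z) * laurentZPow Z (-k - 1) := by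
      have h1 := hC.laurentZPow_add_one (-k - 1)
      have h2 := hZ.laurentZPow_add_one (-k - 1)
      rw [sub_add_cancel] at h1 h2
      rw [h1, h2]
      ring
    rw [e]
    exact (ih.mono (by omega)).sub ((h.mul (hZ.hasDegLE_laurentZPow _)).mono (by omega))

theorem IsNormalized.hasDegLE_pow_sub {C Z : LaurentSeries R} (hC : IsNormalized C)
    (hZ : IsNormalized Z) {s : ℤ} (h : HasDegLE (C - Z) s) (k : ℕ) :
    HasDegLE (C ^ k - Z ^ k) (s + k - 1) :=
  hC.hasDegLE_laurentZPow_sub hZ h k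

/-- The cofactor of `C - Z` in `C ^ n - Z ^ n`. -/
theorem HasDegLE.geom_sum {C Z : LaurentSeries R} (hC : HasDegLE C 1) (hC1 : xCoeff C 1 = 1)
    (hZ : HasDegLE Z 1) (hZ1 : xCoeff Z 1 = 1) (n : ℕ) :
    HasDegLE (∑ i ∈ Finset.range n, C ^ i * Z ^ (n - 1 - i)) (n - 1) ∧
      xCoeff (∑ i ∈ Finset.range n, C ^ i * Z ^ (n - 1 - i)) (n - 1) = n := by
  have hd : ∀ i ∈ Finset.range n, ((i : ℤ) * 1 + ((n - 1 - i : ℕ) : ℤ) * 1) = n - 1 := by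
    intro i hi
    rw [Finset.mem_range] at hi
    omega
  have key : ∀ i ∈ Finset.range n, HasDegLE (C ^ i * Z ^ (n - 1 - i)) (n - 1) ∧
      xCoeff (C ^ i * Z ^ (n - 1 - i)) (n - 1) = 1 := by
    intro i hi
    rw [← hd i hi, (hC.pow i).xCoeff_mul (hZ.pow _), hC.xCoeff_pow, hZ.xCoeff_pow, hC1, hZ1,
      one_pow, one_pow, one_mul]
    exact ⟨(hC.pow i).mul (hZ.pow _), rfl⟩
  refine ⟨HasDegLE.sum fun i hi => (key i hi).1, ?_⟩
  rw [xCoeff_sum, Finset.sum_congr rfl fun i hi => (key i hi).2]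
  simp

/-- In `C ^ n - Z ^ n = (∑ C ^ i Z ^ (n-1-i)) (C - Z)` the first factor has leading term `n x ^ (n -
1)` with `n` a unit, so it can be divided out. -/
theorem HasDegLE.sub_of_pow {C Z : LaurentSeries R} (hC : HasDegLE C 1) (hC1 : xCoeff C 1 = 1)
    (hZ : HasDegLE Z 1) (hZ1 : xCoeff Z 1 = 1) {n : ℕ} (hu : IsUnit (n : R)) {s : ℤ}
    (h : HasDegLE (C ^ n - Z ^ n) (n - 1 + s)) : HasDegLE (C - Z) s := by
  obtain ⟨h1, h2⟩ := hC.geom_sum hC1 hZ hZ1 n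
  refine h1.of_mul (by rwa [h2]) ?_
  rwa [Commute.geom_sum₂_mul (Commute.all C Z)]

theorem HasDegLE.eq_of_pow_eq {C Z : LaurentSeries R} (hC : HasDegLE C 1)
    (hC1 : xCoeff C 1 = 1) (hZ : HasDegLE Z 1) (hZ1 : xCoeff Z 1 = 1) {n : ℕ}
    (hu : IsUnit (n : R)) (h : C ^ n = Z ^ n) : C = Z := by
  rw [← sub_eq_zero]
  refine eq_zero_of_hasDegLE fun s => hC.sub_of_pow hC1 hZ hZ1 hu ?_
  rw [h, sub_self]
  exact HasDegLE.zero

end Degree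

/-! ### Polynomials inside Laurent series, polynomial parts, change of coefficients. -/

section Polynomials

variable {R S : Type*} [CommRing R] [CommRing S]

theorem xMonomial_mul (j k : ℤ) (a b : R) :
    xMonomial j a * xMonomial k b = xMonomial (j + k) (a * b) := by
  rw [xMonomial, xMonomial, xMonomial, HahnSeries.single_mul_single, neg_add]

theorem xMonomial_pow (j : ℤ) (a : R) (k : ℕ) :
    xMonomial j a ^ k = xMonomial (k * j) (a ^ k) := by
  rw [xMonomial, xMonomial, HahnSeries.single_pow]
  simp

theorem polyToLaurent_monomial (k : ℕ) (c : R) :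
    polyToLaurent (monomial k c) = xMonomial k c := by
  rw [polyToLaurent, coe_eval₂RingHom, eval₂_monomial, xMonomial_pow]
  change xMonomial 0 c * _ = _
  rw [xMonomial_mul]
  simp

theorem polyToLaurent_C (c : R) : polyToLaurent (C c) = xMonomial 0 c := by
  simpa using polyToLaurent_monomial 0 c

theorem polyToLaurent_X : polyToLaurent (X : R[X]) = xMonomial 1 1 := by
  simpa [monomial_one_one_eq_X] using polyToLaurent_monomial 1 (1 : R)

theorem xCoeff_polyToLaurent_natCast (P : R[X]) (k : ℕ) :
    xCoeff (polyToLaurent P) k = P.coeff k := by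
  induction P using Polynomial.induction_on' with
  | add p q hp hq => simp [hp, hq]
  | monomial j a =>
    rw [polyToLaurent_monomial, xCoeff_xMonomial, coeff_monomial]
    simp [eq_comm]

theorem xCoeff_polyToLaurent_of_neg (P : R[X]) {k : ℤ} (hk : k < 0) :
    xCoeff (polyToLaurent P) k = 0 := by
  induction P using Polynomial.induction_on' with
  | add p q hp hq => simp [hp, hq]
  | monomial j a =>
    rw [polyToLaurent_monomial, xCoeff_xMonomial, if_neg (by omega)]

theorem hasDegLE_polyToLaurent_iff {P : R[X]} {k : ℕ} :
    HasDegLE (polyToLaurent P) k ↔ P.natDegree ≤ k := by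
  rw [natDegree_le_iff_coeff_eq_zero]
  constructor
  · intro h j hj
    rw [← xCoeff_polyToLaurent_natCast]
    exact h j (by omega)
  · intro h j hj
    obtain ⟨j, rfl⟩ := Int.eq_ofNat_of_zero_le (by omega : 0 ≤ j)
    rw [xCoeff_polyToLaurent_natCast]
    exact h j (by omega)

theorem polyToLaurent_injective : Function.Injective (polyToLaurent : R[X] → LaurentSeries R) := by
  intro P Q h
  ext k
  rw [← xCoeff_polyToLaurent_natCast, h, xCoeff_polyToLaurent_natCast]

/-- The part of `H` in degrees `0, …, d`. -/
def polyPart (d : ℕ) (H : LaurentSeries R) : R[X] :=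
  ∑ k ∈ Finset.range (d + 1), monomial k (xCoeff H k)

theorem coeff_polyPart (d : ℕ) (H : LaurentSeries R) (k : ℕ) :
    (polyPart d H).coeff k = if k ≤ d then xCoeff H k else 0 := by
  simp [polyPart, coeff_monomial]

theorem HasDegLE.sub_polyPart {H : LaurentSeries R} {d : ℕ} (h : HasDegLE H d) :
    HasDegLE (H - polyToLaurent (polyPart d H)) (-1) := by
  intro j hj
  obtain ⟨j, rfl⟩ := Int.eq_ofNat_of_zero_le (by omega : 0 ≤ j)
  rw [xCoeff_sub, xCoeff_polyToLaurent_natCast, coeff_polyPart]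
  split_ifs with hjd
  · exact sub_self _
  · rw [h _ (by omega), sub_zero]

theorem eq_polyPart {H : LaurentSeries R} {P : R[X]} {d : ℕ}
    (h : HasDegLE H d) (hP : HasDegLE (polyToLaurent P - H) (-1)) : P = polyPart d H := by
  ext k
  have h1 := hP k (by omega)
  rw [xCoeff_sub, xCoeff_polyToLaurent_natCast, sub_eq_zero] at h1
  rw [coeff_polyPart, h1]
  split_ifs with hk
  · rfl
  · exact h _ (by omega)

/-- The ring homomorphism applying `φ` to the coefficients of a Laurent series. -/
def laurentMap (φ : R →+* S) : LaurentSeries R →+* LaurentSeries S where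
  toFun H := H.map φ
  map_zero' := by ext; simp
  map_one' := by ext k; simp only [HahnSeries.map_coeff, HahnSeries.coeff_one]; split_ifs <;> simp
  map_add' U V := by ext; simp
  map_mul' U V := HahnSeries.map_mul (φ : R →ₙ+* S)

@[simp] theorem xCoeff_laurentMap (φ : R →+* S) (H : LaurentSeries R) (k : ℤ) :
    xCoeff (laurentMap φ H) k = φ (xCoeff H k) := rfl

theorem laurentMap_injective {φ : R →+* S} (hφ : Function.Injective φ) :
    Function.Injective (laurentMap φ) := fun U V h => laurent_ext fun k => hφ (by
  rw [← xCoeff_laurentMap, h, xCoeff_laurentMap])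

theorem laurentMap_smul (φ : R →+* S) (r : R) (H : LaurentSeries R) :
    laurentMap φ (r • H) = φ r • laurentMap φ H := laurent_ext fun k => by simp

theorem laurentMap_xMonomial (φ : R →+* S) (k : ℤ) (c : R) :
    laurentMap φ (xMonomial k c) = xMonomial k (φ c) := laurent_ext fun j => by
  rw [xCoeff_laurentMap, xCoeff_xMonomial, xCoeff_xMonomial]
  split_ifs <;> simp

theorem laurentMap_polyToLaurent (φ : R →+* S) (P : R[X]) :
    laurentMap φ (polyToLaurent P) = polyToLaurent (P.map φ) := by
  induction P using Polynomial.induction_on' with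
  | add p q hp hq => simp [hp, hq]
  | monomial j a =>
    rw [polyToLaurent_monomial, laurentMap_xMonomial, map_monomial, polyToLaurent_monomial]

theorem polyPart_laurentMap (φ : R →+* S) (d : ℕ) (H : LaurentSeries R) :
    polyPart d (laurentMap φ H) = (polyPart d H).map φ := by
  ext k
  rw [coeff_map, coeff_polyPart, coeff_polyPart]
  split_ifs <;> simp

theorem IsNormalized.laurentMap (φ : R →+* S) {C : LaurentSeries R} (hC : IsNormalized C) :
    IsNormalized (laurentMap φ C) where
  coeff_one := by simp [hC.coeff_one]
  coeff_zero := by simp [hC.coeff_zero]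
  coeff_of_one_lt k hk := by simp [hC.coeff_of_one_lt k hk]

theorem IsNormalized.laurentMap_laurentZPow (φ : R →+* S) {C : LaurentSeries R}
    (hC : IsNormalized C) (k : ℤ) :
    _root_.laurentMap φ (laurentZPow C k) = laurentZPow (_root_.laurentMap φ C) k := by
  rw [hC.laurentZPow_eq, (hC.laurentMap φ).laurentZPow_eq]
  have : (hC.laurentMap φ).isUnit.unit =
      Units.map (_root_.laurentMap φ : LaurentSeries R →* LaurentSeries S) hC.isUnit.unit := by
    ext1; rfl
  rw [this, ← map_zpow]
  rfl

end Polynomials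

/-! ### Functoriality of the systems in the coefficient ring. -/

section Systems

variable {K R S : Type*} [Field K] [CommRing R] [Algebra K R] [CommRing S] [Algebra K S]

/-- The series `∑ λᵢ C ^ (m - i)`. -/
def lamSum (n m : ℕ) (lam : ℕ → K) (C : LaurentSeries R) : LaurentSeries R :=
  ∑ i ∈ Finset.range (m + n - 1), algebraMap K R (lam i) • laurentZPow C ((m : ℤ) - (i : ℤ))

theorem laurentMap_lamSum (φ : R →ₐ[K] S) (n m : ℕ) (lam : ℕ → K) {C : LaurentSeries R}
    (hC : IsNormalized C) :
    laurentMap (φ : R →+* S) (lamSum n m lam C) =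
      lamSum n m lam (laurentMap (φ : R →+* S) C) := by
  simp only [lamSum, map_sum, laurentMap_smul]
  refine Finset.sum_congr rfl fun i _ => ?_
  rw [hC.laurentMap_laurentZPow]
  simp

theorem IsNormalized.hasDegLE_lamSum {C : LaurentSeries R} (hC : IsNormalized C) (n m : ℕ)
    (lam : ℕ → K) : HasDegLE (lamSum n m lam C) m :=
  HasDegLE.sum fun i _ => ((hC.hasDegLE_laurentZPow _).mono (by omega)).smul _

theorem IsNormalized.hasDegLE_lamSum_sub {C Z : LaurentSeries R} (hC : IsNormalized C)
    (hZ : IsNormalized Z) {s : ℤ} (h : HasDegLE (C - Z) s) (n m : ℕ) (lam : ℕ → K) :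
    HasDegLE (lamSum n m lam C - lamSum n m lam Z) (s + m - 1) := by
  rw [lamSum, lamSum, ← Finset.sum_sub_distrib]
  refine HasDegLE.sum fun i _ => ?_
  rw [← smul_sub]
  exact ((hC.hasDegLE_laurentZPow_sub hZ h _).mono (by omega)).smul _

theorem IsSolutionWithPair.map (φ : R →ₐ[K] S) {n m : ℕ} {lam : ℕ → K} {f : R}
    {C : LaurentSeries R} {P Q : R[X]} (h : IsSolutionWithPair n m lam f C P Q) :
    IsSolutionWithPair n m lam (φ f) (laurentMap (φ : R →+* S) C) (P.map (φ : R →+* S))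
      (Q.map (φ : R →+* S)) where
  normalized := h.normalized.laurentMap _
  eq_pow := by rw [← laurentMap_polyToLaurent, h.eq_pow, map_pow]
  eq_sum := by
    obtain ⟨F, h1, h2, h3⟩ := h.eq_sum
    refine ⟨laurentMap (φ : R →+* S) F, fun k hk => by simp [h1 k hk], by simp [h2], ?_⟩
    rw [← laurentMap_polyToLaurent, h3, map_add]
    congr 1
    exact laurentMap_lamSum φ n m lam h.normalized

theorem IsSolution.map (φ : R →ₐ[K] S) {n m : ℕ} {lam : ℕ → K} {f : R}
    {C : LaurentSeries R} (h : IsSolution n m lam f C) :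
    IsSolution n m lam (φ f) (laurentMap (φ : R →+* S) C) := by
  obtain ⟨P, Q, h⟩ := h
  exact ⟨_, _, h.map φ⟩

theorem IsRegularSolution.map (φ : R →ₐ[K] S) {n m : ℕ} {lam : ℕ → K} {f : R}
    {C : LaurentSeries R} (h : IsRegularSolution n m lam f C) :
    IsRegularSolution n m lam (φ f) (laurentMap (φ : R →+* S) C) := by
  obtain ⟨P, Q, h, A, B, hAB⟩ := h
  refine ⟨_, _, h.map φ, A.map (φ : R →+* S), B.map (φ : R →+* S), ?_⟩
  simpa using congrArg (Polynomial.map (φ : R →+* S)) hAB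

end Systems

/-! ### Power series in `x⁻¹` and extraction of `n`-th roots. -/

section PowerSeriesCoeff

variable {R : Type*} [CommRing R]

theorem xCoeff_ofPowerSeries_neg (a : PowerSeries R) (k : ℕ) :
    xCoeff (HahnSeries.ofPowerSeries ℤ R a) (-k) = PowerSeries.coeff k a := by
  rw [xCoeff, neg_neg]
  exact HahnSeries.ofPowerSeries_apply_coeff a k

theorem hasDegLE_ofPowerSeries (a : PowerSeries R) :
    HasDegLE (HahnSeries.ofPowerSeries ℤ R a) 0 := fun j hj => by
  rw [xCoeff, PowerSeries.coeff_coe, if_pos (by omega)]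

theorem HasDegLE.exists_powerSeries {H : LaurentSeries R} (h : HasDegLE H 0) :
    ∃ a : PowerSeries R, HahnSeries.ofPowerSeries ℤ R a = H := by
  refine ⟨PowerSeries.mk fun k => xCoeff H (-k), laurent_ext fun k => ?_⟩
  rcases lt_or_ge 0 k with hk | hk
  · rw [h k hk, hasDegLE_ofPowerSeries _ k hk]
  · obtain ⟨k, rfl⟩ := Int.exists_eq_neg_ofNat hk
    rw [xCoeff_ofPowerSeries_neg, PowerSeries.coeff_mk]

end PowerSeriesCoeff

section Roots

variable {M : Type*} [Field M]

/-- Hensel's lemma for the `X`-adic topology: `1` is a root of `T ^ n - h` modulo `X`, and the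
derivative there is the unit `n`. -/
theorem exists_powerSeries_pow_eq {n : ℕ} (hn : n ≠ 0) (hn' : (n : M) ≠ 0) (h : PowerSeries M)
    (h0 : PowerSeries.constantCoeff h = 1) :
    ∃ a : PowerSeries M, a ^ n = h ∧ PowerSeries.constantCoeff a = 1 := by
  have hu : IsUnit ((n : PowerSeries M)) := by
    rw [← map_natCast (PowerSeries.C (R := M)) n]
    exact (IsUnit.mk0 _ hn').map _
  have h1 : (X ^ n - C h : (PowerSeries M)[X]).eval 1 ∈
      Ideal.span {(PowerSeries.X : PowerSeries M)} := by
    rw [Ideal.mem_span_singleton, PowerSeries.X_dvd_iff, eval_sub, eval_pow, eval_X, eval_C,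
      one_pow, map_sub, h0, map_one, sub_self]
  have h2 : IsUnit ((derivative (X ^ n - C h : (PowerSeries M)[X])).eval 1) := by
    rw [derivative_sub, derivative_C, derivative_X_pow, sub_zero, eval_mul, eval_pow, eval_X,
      one_pow, mul_one, eval_C]
    exact hu
  obtain ⟨a, ha, ha1⟩ := HenselianRing.is_henselian (R := PowerSeries M)
    (I := Ideal.span {(PowerSeries.X : PowerSeries M)})
    (X ^ n - C h) (monic_X_pow_sub_C h hn) 1 h1 (h2.map _)
  refine ⟨a, ?_, ?_⟩
  · rw [IsRoot.def, eval_sub, eval_pow, eval_X, eval_C, sub_eq_zero] at ha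
    exact ha
  · rw [Ideal.mem_span_singleton, PowerSeries.X_dvd_iff, map_sub, map_one, sub_eq_zero] at ha1
    exact ha1

/-- Write `H = x ^ n a` with `a` a power series in `x⁻¹` of constant term `1`, and take `C = x b`
with `b ^ n = a`. The missing term in `x ^ (n - 1)` is what kills the constant term of `C`. -/
theorem exists_isNormalized_pow_eq {n : ℕ} (hn' : (n : M) ≠ 0) {H : LaurentSeries M}
    (h : HasDegLE H n) (h1 : xCoeff H n = 1) (h0 : xCoeff H (n - 1) = 0) :
    ∃ C : LaurentSeries M, IsNormalized C ∧ C ^ n = H := by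
  have hn : n ≠ 0 := by rintro rfl; simp at hn'
  obtain ⟨a, ha⟩ := HasDegLE.exists_powerSeries
    (((HasDegLE.xMonomial (-n) (1 : M)).mul h).mono (by omega : -(n : ℤ) + n ≤ 0))
  have ha0 : PowerSeries.constantCoeff a = 1 := by
    rw [← PowerSeries.coeff_zero_eq_constantCoeff_apply, ← xCoeff_ofPowerSeries_neg, ha]
    have := (HasDegLE.xMonomial (-n) (1 : M)).xCoeff_mul h
    simpa [h1, xCoeff_xMonomial] using this
  obtain ⟨b, hb, hb0⟩ := exists_powerSeries_pow_eq hn hn' a ha0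
  have hd := ((HasDegLE.xMonomial 1 (1 : M)).mul (hasDegLE_ofPowerSeries b))
  have hc := ((HasDegLE.xMonomial 1 (1 : M)).xCoeff_mul (hasDegLE_ofPowerSeries b))
  have e0 : xCoeff (HahnSeries.ofPowerSeries ℤ M b) 0 = 1 := by
    have := xCoeff_ofPowerSeries_neg b 0
    simpa [hb0] using this
  rw [e0, add_zero, xCoeff_xMonomial, if_pos rfl, one_mul] at hc
  rw [add_zero] at hd
  set C := xMonomial 1 (1 : M) * HahnSeries.ofPowerSeries ℤ M b with hC
  have hCn : C ^ n = H := by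
    rw [hC, mul_pow, ← map_pow, hb, ha, ← mul_assoc, xMonomial_pow, xMonomial_mul]
    have : ((n : ℤ) * 1 + -n) = 0 := by ring
    rw [this, one_pow, one_mul]
    exact one_mul H
  have hx1 : xCoeff (xMonomial 1 (1 : M)) 1 = 1 := by simp [xCoeff_xMonomial]
  have hsub : HasDegLE (C - xMonomial 1 1) (-1) := by
    refine hd.sub_of_pow hc (HasDegLE.xMonomial _ _) hx1 (IsUnit.mk0 _ hn') ?_
    rw [hCn, xMonomial_pow, one_pow, mul_one]
    intro j hj
    rw [xCoeff_sub, xCoeff_xMonomial]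
    split_ifs with hjn
    · rw [hjn, h1, sub_self]
    · rcases eq_or_ne j (n - 1) with rfl | hne
      · rw [h0, sub_zero]
      · rw [h j (by omega), sub_zero]
  refine ⟨C, ⟨hc, ?_, hd⟩, hCn⟩
  have := hsub 0 (by omega)
  rw [xCoeff_sub, xCoeff_xMonomial, if_neg (by omega), sub_zero] at this
  exact this

end Roots

/-! ### Truncated series, and solutions as points of the standard system. -/

section Truncation

variable {R S : Type*} [CommRing R] [CommRing S]

/-- The Laurent polynomial `x + z₀ x⁻¹ + ⋯ + z_{N-1} x^(-N)`. -/
def truncSeries {N : ℕ} (z : Fin N → R) : LaurentSeries R :=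
  xMonomial 1 1 + ∑ k : Fin N, xMonomial (-((k : ℤ) + 1)) (z k)

theorem xCoeff_truncSeries {N : ℕ} (z : Fin N → R) (j : ℤ) :
    xCoeff (truncSeries z) j =
      (if j = 1 then 1 else 0) + ∑ k : Fin N, if j = -((k : ℤ) + 1) then z k else 0 := by
  simp [truncSeries, xCoeff_xMonomial]

theorem xCoeff_truncSeries_neg {N : ℕ} (z : Fin N → R) (k : Fin N) :
    xCoeff (truncSeries z) (-((k : ℤ) + 1)) = z k := by
  rw [xCoeff_truncSeries, if_neg (by omega), zero_add, Finset.sum_eq_single k]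
  · simp
  · intro b _ hb
    rw [if_neg]
    intro h
    exact hb (Fin.ext (by omega))
  · simp

theorem truncSeries_isNormalized {N : ℕ} (z : Fin N → R) : IsNormalized (truncSeries z) := by
  constructor
  · rw [xCoeff_truncSeries, Finset.sum_eq_zero]
    · simp
    · exact fun k _ => if_neg (by omega)
  · rw [xCoeff_truncSeries, Finset.sum_eq_zero]
    · simp
    · exact fun k _ => if_neg (by omega)
  · intro j hj
    rw [xCoeff_truncSeries, Finset.sum_eq_zero]
    · rw [if_neg (by omega), zero_add]
    · exact fun k _ => if_neg (by omega)

theorem IsNormalized.hasDegLE_sub_truncSeries_iff {N : ℕ} {C : LaurentSeries R}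
    (hC : IsNormalized C) (z : Fin N → R) :
    HasDegLE (C - truncSeries z) (-(N + 1)) ↔ ∀ k : Fin N, xCoeff C (-((k : ℤ) + 1)) = z k := by
  constructor
  · intro h k
    have := h (-((k : ℤ) + 1)) (by omega)
    rwa [xCoeff_sub, xCoeff_truncSeries_neg, sub_eq_zero] at this
  · intro h j hj
    have hZ := truncSeries_isNormalized z
    rw [xCoeff_sub, sub_eq_zero]
    rcases lt_trichotomy j 0 with hj0 | rfl | hj0
    · obtain ⟨k, rfl⟩ : ∃ k : Fin N, j = -((k : ℤ) + 1) :=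
        ⟨⟨(-j - 1).toNat, by omega⟩, by simp; omega⟩
      rw [h, xCoeff_truncSeries_neg]
    · rw [hC.coeff_zero, hZ.coeff_zero]
    · rcases eq_or_ne j 1 with rfl | hj1
      · rw [hC.coeff_one, hZ.coeff_one]
      · rw [hC.coeff_of_one_lt j (by omega), hZ.coeff_of_one_lt j (by omega)]

theorem laurentMap_truncSeries (φ : R →+* S) {N : ℕ} (z : Fin N → R) :
    laurentMap φ (truncSeries z) = truncSeries (φ ∘ z) := by
  simp [truncSeries, laurentMap_xMonomial]

theorem genericSeries_eq (N : ℕ) : genericSeries R N = truncSeries MvPolynomial.X := rfl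

end Truncation

section StandardSystem

variable {K L R : Type*} [Field K] [CommRing R] [Algebra K R]

/-- The standard system evaluated at the point `z`. -/
structure IsSystemZero (n m : ℕ) (lam : ℕ → K) (f : R) (z : Fin (m + n - 2) → R) : Prop where
  pow : ∀ j : ℤ, -(m : ℤ) < j → j < 0 → xCoeff (truncSeries z ^ n) j = 0
  sum : ∀ j : ℤ, 1 - (n : ℤ) < j → j < 0 → xCoeff (lamSum n m lam (truncSeries z)) j = 0
  last : xCoeff (lamSum n m lam (truncSeries z)) (1 - (n : ℤ)) = -f

theorem map_standardSystem [CommRing L] [Algebra K L] [Algebra L R] [IsScalarTower K L R]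
    {n m : ℕ} (lam : ℕ → K) (f : L) (ψ : MvPolynomial (Fin (m + n - 2)) L →ₐ[L] R)
    (i : Fin (m + n - 2)) :
    ψ (standardSystem n m lam f i) =
      if (i : ℕ) + 1 < m then
        xCoeff (truncSeries (fun k => ψ (MvPolynomial.X k)) ^ n) (-((i : ℤ) + 1))
      else
        xCoeff (lamSum n m lam (truncSeries (fun k => ψ (MvPolynomial.X k))))
          ((m : ℤ) - ((i : ℤ) + 1) - 1)
        + (if (i : ℕ) + 1 = m + n - 2 then algebraMap L R f else 0) := by
  have hZ : laurentMap (ψ : MvPolynomial (Fin (m + n - 2)) L →+* R)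
      (genericSeries L (m + n - 2)) = truncSeries (fun k => ψ (MvPolynomial.X k)) := by
    rw [genericSeries_eq, laurentMap_truncSeries]
    rfl
  rw [standardSystem]
  split_ifs with h1 h2
  · rw [← hZ, ← map_pow]
    rfl
  · rw [← hZ, map_add]
    congr 1
    · have := laurentMap_lamSum (ψ.restrictScalars K) n m lam
        (genericSeries_isNormalized L (m + n - 2))
      exact congrArg (fun H => xCoeff H ((m : ℤ) - ((i : ℤ) + 1) - 1)) this
    · exact ψ.commutes f
  · rw [← hZ, map_add, map_zero]
    congr 1
    have := laurentMap_lamSum (ψ.restrictScalars K) n m lam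
        (genericSeries_isNormalized L (m + n - 2))
    exact congrArg (fun H => xCoeff H ((m : ℤ) - ((i : ℤ) + 1) - 1)) this

theorem map_standardSystem_eq_zero_iff [CommRing L] [Algebra K L] [Algebra L R]
    [IsScalarTower K L R] {n m : ℕ} (hn : 2 ≤ n) (hm : 2 ≤ m) (lam : ℕ → K) (f : L)
    (ψ : MvPolynomial (Fin (m + n - 2)) L →ₐ[L] R) :
    (∀ i, ψ (standardSystem n m lam f i) = 0) ↔
      IsSystemZero n m lam (algebraMap L R f) (fun k => ψ (MvPolynomial.X k)) := by
  simp only [map_standardSystem]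
  constructor
  · intro h
    constructor
    · intro j hj hj0
      -- Indices are shifted by one: degree `j` of `Z ^ n` is read by `E_{-j}`. Below, degree `j` of
      -- the `λ`-sum is read by `E_{m-1-j}`, and degree `1 - n` by the last equation.
      have := h ⟨(-j - 1).toNat, by omega⟩
      rw [if_pos (by simp; omega)] at this
      convert this using 2
      simp
      omega
    · intro j hj hj0
      have := h ⟨(m - j - 2).toNat, by omega⟩
      rw [if_neg (by simp; omega), if_neg (by simp; omega), add_zero] at this
      convert this using 2
      simp
      omega
    · have := h ⟨m + n - 3, by omega⟩
      rw [if_neg (by simp; omega), if_pos (by simp; omega)] at this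
      rw [eq_neg_iff_add_eq_zero]
      convert this using 3
      simp
      omega
  · intro h i
    have hi := i.2
    split_ifs with h1 h2
    · exact h.pow _ (by omega) (by omega)
    · have e : (m : ℤ) - ((i : ℤ) + 1) - 1 = 1 - n := by omega
      rw [e, h.last, neg_add_cancel]
    · rw [add_zero]
      exact h.sum _ (by omega) (by omega)

variable {n m : ℕ} {lam : ℕ → K} {f : R} {C : LaurentSeries R}

/-- `C` agrees with its truncation down to degree `-(m + n - 2)`, so `C ^ n` and the `λ`-sum move
only in degrees `≤ -m` and `≤ -n`. The term `F` has negative degree too, so none of this touches the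
polynomial parts. -/
theorem IsSolutionWithPair.eq_polyPart {P Q : R[X]} (hn : 2 ≤ n) (hm : 2 ≤ m)
    (h : IsSolutionWithPair n m lam f C P Q) {z : Fin (m + n - 2) → R}
    (hz : ∀ k : Fin (m + n - 2), xCoeff C (-((k : ℤ) + 1)) = z k) :
    P = polyPart n (truncSeries z ^ n) ∧ Q = polyPart m (lamSum n m lam (truncSeries z)) := by
  have hC := h.normalized
  have hZ := truncSeries_isNormalized z
  have hd := (hC.hasDegLE_sub_truncSeries_iff z).2 hz
  constructor
  · refine _root_.eq_polyPart (by simpa using hZ.hasDegLE.pow n) ?_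
    rw [h.eq_pow]
    exact (hC.hasDegLE_pow_sub hZ hd n).mono (by omega)
  · refine _root_.eq_polyPart (hZ.hasDegLE_lamSum n m lam) ?_
    obtain ⟨F, h1, -, h3⟩ := h.eq_sum
    rw [h3, add_sub_right_comm]
    exact ((hC.hasDegLE_lamSum_sub hZ hd n m lam).mono (by omega)).add
      (HasDegLE.mono (a := 1 - n) h1 (by omega))

theorem IsSolution.isSystemZero (hn : 2 ≤ n) (hm : 2 ≤ m) (h : IsSolution n m lam f C) :
    IsSystemZero n m lam f (fun k : Fin (m + n - 2) => xCoeff C (-((k : ℤ) + 1))) := by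
  obtain ⟨P, Q, h⟩ := h
  set z := fun k : Fin (m + n - 2) => xCoeff C (-((k : ℤ) + 1)) with hz
  have hC := h.normalized
  have hZ := truncSeries_isNormalized z
  have hd := (hC.hasDegLE_sub_truncSeries_iff z).2 fun k => rfl
  obtain ⟨F, h1, h2, h3⟩ := h.eq_sum
  have hQ : ∀ j : ℤ, -(n : ℤ) < j → j < 0 →
      xCoeff (lamSum n m lam (truncSeries z)) j = -xCoeff F j := by
    intro j hj hj0
    have e1 := (hC.hasDegLE_lamSum_sub hZ hd n m lam) j (by omega)
    have e2 := xCoeff_polyToLaurent_of_neg Q hj0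
    rw [h3, xCoeff_add] at e2
    rw [xCoeff_sub, sub_eq_zero] at e1
    rw [← e1, eq_neg_iff_add_eq_zero]
    exact e2
  refine ⟨fun j hj hj0 => ?_, fun j hj hj0 => ?_, ?_⟩
  · have e1 := (hC.hasDegLE_pow_sub hZ hd n) j (by omega)
    rwa [← h.eq_pow, xCoeff_sub, xCoeff_polyToLaurent_of_neg P hj0, zero_sub, neg_eq_zero] at e1
  · rw [hQ j (by omega) hj0, h1 j (by omega), neg_zero]
  · rw [hQ _ (by omega) (by omega), h2]

/-- The truncation determines `P`, and `C` is the only normalized `n`-th root of `P`. -/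
theorem IsSolution.eq_of_xCoeff_eq {C' : LaurentSeries R} (hn : 2 ≤ n) (hm : 2 ≤ m) (hu : IsUnit (n : R))
    (h : IsSolution n m lam f C) (h' : IsSolution n m lam f C')
    (hz : ∀ k : Fin (m + n - 2), xCoeff C (-((k : ℤ) + 1)) = xCoeff C' (-((k : ℤ) + 1))) :
    C = C' := by
  obtain ⟨P, Q, h⟩ := h
  obtain ⟨P', Q', h'⟩ := h'
  refine h.normalized.hasDegLE.eq_of_pow_eq h.normalized.coeff_one h'.normalized.hasDegLE
    h'.normalized.coeff_one hu ?_
  rw [← h.eq_pow, ← h'.eq_pow, (h.eq_polyPart hn hm hz).1, (h'.eq_polyPart hn hm fun _ => rfl).1]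

/-- The equations on `Z ^ n` say that it differs from its polynomial part `P` only in degrees `≤
-m`. The `n`-th root `C` of `P` is then so close to the truncated series that the `λ`-sum is
unchanged in degrees `> -n`, where the other equations prescribe it. -/
theorem IsSystemZero.exists_isSolutionWithPair {M : Type*} [Field M] [CharZero M] [Algebra K M]
    {f : M} {z : Fin (m + n - 2) → M} (hn : 2 ≤ n) (hm : 2 ≤ m)
    (h : IsSystemZero n m lam f z) :
    ∃ C : LaurentSeries M, (∀ k : Fin (m + n - 2), xCoeff C (-((k : ℤ) + 1)) = z k) ∧
      IsSolutionWithPair n m lam f C (polyPart n (truncSeries z ^ n))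
        (polyPart m (lamSum n m lam (truncSeries z))) := by
  have hZ := truncSeries_isNormalized z
  have hZn : HasDegLE (truncSeries z ^ n) n := by simpa using hZ.hasDegLE.pow n
  have hn0 : (n : M) ≠ 0 := by simp; omega
  set P := polyPart n (truncSeries z ^ n) with hP
  set Q := polyPart m (lamSum n m lam (truncSeries z)) with hQ
  have hPZ : HasDegLE (polyToLaurent P - truncSeries z ^ n) (-m) := by
    intro j hj
    rcases lt_or_ge j 0 with hj0 | hj0
    · rw [xCoeff_sub, xCoeff_polyToLaurent_of_neg _ hj0, h.pow j hj hj0, sub_zero]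
    · have := hZn.sub_polyPart j (by omega)
      rw [xCoeff_sub, sub_eq_zero] at this ⊢
      exact this.symm
  -- This gives `P` no term in `x ^ (n - 1)`, as needed for a normalized root.
  have hxn : HasDegLE (truncSeries z ^ n - xMonomial 1 1 ^ n) (n - 2) := by
    have hx : IsNormalized (xMonomial 1 (1 : M)) := by
      constructor <;> simp +contextual [xCoeff_xMonomial]
      intro k hk hk1
      omega
    refine (hZ.hasDegLE_pow_sub (s := -1) hx ?_ n).mono (by omega)
    intro j hj
    rw [xCoeff_sub, sub_eq_zero]
    rcases lt_trichotomy j 1 with h1 | rfl | h1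
    · obtain rfl : j = 0 := by omega
      rw [hZ.coeff_zero, hx.coeff_zero]
    · rw [hZ.coeff_one, hx.coeff_one]
    · rw [hZ.coeff_of_one_lt j h1, hx.coeff_of_one_lt j h1]
  have hPx : ∀ j : ℤ, (n : ℤ) - 2 < j → xCoeff (polyToLaurent P) j = if j = n then 1 else 0 := by
    intro j hj
    have e1 := hPZ j (by omega)
    have e2 := hxn j hj
    rw [xMonomial_pow, mul_one, one_pow, xCoeff_sub, xCoeff_xMonomial, sub_eq_zero] at e2
    rw [xCoeff_sub, sub_eq_zero] at e1
    rw [e1, e2]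
  obtain ⟨C, hC, hCn⟩ := exists_isNormalized_pow_eq hn0 (H := polyToLaurent P)
    (fun j hj => by rw [hPx j (by omega), if_neg (by omega)])
    (by rw [hPx _ (by omega), if_pos rfl]) (by rw [hPx _ (by omega), if_neg (by omega)])
  -- Dividing by a cofactor of degree `n - 1` turns the bound `-m` into `-m - (n - 1)`.
  have hd : HasDegLE (C - truncSeries z) (-((m + n - 2 : ℕ) + 1)) := by
    refine hC.hasDegLE.sub_of_pow hC.coeff_one hZ.hasDegLE hZ.coeff_one (IsUnit.mk0 _ hn0) ?_
    rw [hCn]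
    exact hPZ.mono (by omega)
  have hlam := hC.hasDegLE_lamSum_sub hZ hd n m lam
  refine ⟨C, (hC.hasDegLE_sub_truncSeries_iff z).1 hd, hC, hCn.symm,
    polyToLaurent Q - lamSum n m lam C, fun k hk => ?_, ?_, ?_⟩
  · have e1 := hlam k (by omega)
    rw [xCoeff_sub, sub_eq_zero] at e1 ⊢
    rw [e1]
    rcases lt_or_ge k 0 with hk0 | hk0
    · rw [xCoeff_polyToLaurent_of_neg _ hk0, h.sum k hk hk0]
    · have := (hZ.hasDegLE_lamSum n m lam).sub_polyPart k (by omega)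
      rw [xCoeff_sub, sub_eq_zero] at this
      exact this.symm
  · have e1 := hlam (1 - n) (by omega)
    rw [xCoeff_sub, sub_eq_zero] at e1
    rw [xCoeff_sub, e1, h.last, xCoeff_polyToLaurent_of_neg _ (by omega), sub_neg_eq_add, zero_add]
  · rw [← lamSum, add_sub_cancel]

end StandardSystem

/-! ### Derivations acting on series and on polynomials. -/

section Derivations

variable {M : Type*} [CommRing M]

theorem smul_mul_laurent (r : M) (U V : LaurentSeries M) : r • U * V = r • (U * V) := by
  rw [← HahnSeries.C_mul_eq_smul, ← HahnSeries.C_mul_eq_smul, mul_assoc]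

/-- Coefficientwise application of additive maps to Laurent series. -/
def laurentAddHom (φ : ℤ → M →+ M) : LaurentSeries M →+ LaurentSeries M where
  toFun U :=
    { coeff := fun k => φ k (U.coeff k)
      isPWO_support' := U.isPWO_support.mono fun k hk => by
        rw [HahnSeries.mem_support]
        rintro h
        simp [h] at hk }
  map_zero' := by ext; simp
  map_add' U V := by ext; simp

@[simp] theorem coeff_laurentAddHom (φ : ℤ → M →+ M) (U : LaurentSeries M) (k : ℤ) :
    (laurentAddHom φ U).coeff k = φ k (U.coeff k) := rfl

/-- The coefficientwise application of additive maps compatible with products is a derivation of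
Laurent series. -/
def laurentDerivation (φ : ℤ → M →+ M)
    (hφ : ∀ i j a b, φ (i + j) (a * b) = a * φ j b + b * φ i a) :
    Derivation ℤ (LaurentSeries M) (LaurentSeries M) where
  toFun := laurentAddHom φ
  map_add' := map_add _
  map_smul' r U := by
    rw [Algebra.smul_def, eq_intCast, ← zsmul_eq_mul, map_zsmul]
    rfl
  map_one_eq_zero' := by
    ext k
    have h := hφ 0 0 1 1
    rw [add_zero, one_mul, one_mul, right_eq_add] at h
    rcases eq_or_ne k 0 with rfl | hk
    · simpa using h
    · simp [HahnSeries.coeff_one, hk]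
  leibniz' U V := by
    ext k
    simp only [LinearMap.coe_mk, AddHom.coe_mk, smul_eq_mul, HahnSeries.coeff_add,
      coeff_laurentAddHom]
    rw [HahnSeries.coeff_mul, mul_comm V,
      HahnSeries.coeff_mul_right' V.isPWO_support (fun k hk => by
        rw [HahnSeries.mem_support] at hk ⊢
        rintro h
        simp [h] at hk),
      HahnSeries.coeff_mul_left' U.isPWO_support (fun k hk => by
        rw [HahnSeries.mem_support] at hk ⊢
        rintro h
        simp [h] at hk),
      ← Finset.sum_add_distrib, map_sum]
    refine Finset.sum_congr rfl fun p hp => ?_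
    rw [Finset.mem_antidiagonal] at hp
    rw [← hp.2.2, hφ, mul_comm (V.coeff _)]
    rfl

/-- Coefficientwise application of a derivation to Laurent series. -/
def laurentDeriv (δ : Derivation ℤ M M) : Derivation ℤ (LaurentSeries M) (LaurentSeries M) :=
  laurentDerivation (fun _ => (δ : M →+ M)) fun _ _ a b => δ.leibniz a b

@[simp] theorem xCoeff_laurentDeriv (δ : Derivation ℤ M M) (U : LaurentSeries M) (k : ℤ) :
    xCoeff (laurentDeriv δ U) k = δ (xCoeff U k) := rfl

/-- The derivation `x d/dx` of Laurent series in `x⁻¹`. -/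
def laurentEuler (M : Type*) [CommRing M] :
    Derivation ℤ (LaurentSeries M) (LaurentSeries M) :=
  -- The coefficient of index `k` belongs to `x ^ (-k)`, hence the sign.
  laurentDerivation (fun k => AddMonoidHom.mulLeft ((-k : ℤ) : M)) fun i j a b => by
    simp only [AddMonoidHom.coe_mulLeft]
    push_cast
    ring

@[simp] theorem xCoeff_laurentEuler (U : LaurentSeries M) (k : ℤ) :
    xCoeff (laurentEuler M U) k = (k : M) * xCoeff U k := by
  change ((- -k : ℤ) : M) * _ = _
  rw [neg_neg]
  rfl

theorem HasDegLE.laurentEuler {U : LaurentSeries M} {a : ℤ} (h : HasDegLE U a) :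
    HasDegLE (laurentEuler M U) a := fun j hj => by
  rw [xCoeff_laurentEuler, h j hj, mul_zero]

/-- Coefficientwise application of a derivation to polynomials. -/
def polyDeriv (δ : Derivation ℤ M M) : Derivation ℤ M[X] M[X] :=
  @Differential.mapCoeffs M _ ⟨δ⟩

@[simp] theorem coeff_polyDeriv (δ : Derivation ℤ M M) (P : M[X]) (k : ℕ) :
    (polyDeriv δ P).coeff k = δ (P.coeff k) := rfl

theorem laurentDeriv_polyToLaurent (δ : Derivation ℤ M M) (P : M[X]) :
    laurentDeriv δ (polyToLaurent P) = polyToLaurent (polyDeriv δ P) := laurent_ext fun k => by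
  rw [xCoeff_laurentDeriv]
  rcases lt_or_ge k 0 with hk | hk
  · rw [xCoeff_polyToLaurent_of_neg _ hk, xCoeff_polyToLaurent_of_neg _ hk, map_zero]
  · obtain ⟨k, rfl⟩ := Int.eq_ofNat_of_zero_le hk
    rw [xCoeff_polyToLaurent_natCast, xCoeff_polyToLaurent_natCast, coeff_polyDeriv]

theorem laurentEuler_polyToLaurent (P : M[X]) :
    laurentEuler M (polyToLaurent P) = polyToLaurent (X * derivative P) := laurent_ext fun k => by
  rw [xCoeff_laurentEuler]
  rcases lt_or_ge k 0 with hk | hk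
  · rw [xCoeff_polyToLaurent_of_neg _ hk, xCoeff_polyToLaurent_of_neg _ hk, mul_zero]
  · obtain ⟨k, rfl⟩ := Int.eq_ofNat_of_zero_le hk
    rw [xCoeff_polyToLaurent_natCast, xCoeff_polyToLaurent_natCast]
    cases k with
    | zero => simp
    | succ k => rw [coeff_X_mul, coeff_derivative]; push_cast; ring

end Derivations

/-! ### Vanishing of the Jacobian, and the coprime case. -/

section Jacobian

variable {K M : Type*} [Field K] [Field M] [Algebra K M]
  {n m : ℕ} {lam : ℕ → K} {f : M} {C : LaurentSeries M} {P Q : M[X]}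

theorem laurentZPow_eq_zpow (C : LaurentSeries M) (k : ℤ) : laurentZPow C k = C ^ k := by
  cases k with
  | ofNat k => simp [laurentZPow]
  | negSucc k => rw [laurentZPow, zpow_negSucc, Ring.inverse_eq_inv', inv_pow]

/-- The chain rule for `∑ λᵢ C ^ (m - i)`. -/
theorem derivation_lamSum (E : Derivation ℤ (LaurentSeries M) (LaurentSeries M))
    (hE : ∀ (a : K) (U : LaurentSeries M), E (algebraMap K M a • U) = algebraMap K M a • E U) :
    E (lamSum n m lam C) = (∑ i ∈ Finset.range (m + n - 1),
      algebraMap K M (lam i) • ((m - i : ℤ) • C ^ ((m : ℤ) - i - 1))) * E C := by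
  rw [lamSum, map_sum, Finset.sum_mul]
  refine Finset.sum_congr rfl fun i _ => ?_
  rw [hE, laurentZPow_eq_zpow, Derivation.leibniz_zpow, smul_mul_laurent, smul_eq_mul,
    smul_mul_assoc]

theorem IsSolutionWithPair.natDegree (h : IsSolutionWithPair n m lam f C P Q) :
    P.natDegree = n := by
  have h1 : P.coeff n = 1 := by
    rw [← xCoeff_polyToLaurent_natCast, h.eq_pow]
    simpa [h.normalized.coeff_one] using h.normalized.hasDegLE.xCoeff_pow n
  refine natDegree_eq_of_le_of_coeff_ne_zero ?_ (h1 ▸ one_ne_zero)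
  rw [← hasDegLE_polyToLaurent_iff, h.eq_pow]
  simpa using h.normalized.hasDegLE.pow n

theorem HasDegLE.laurentDeriv_of_isNormalized (hC : IsNormalized C) (δ : Derivation ℤ M M) :
    HasDegLE (laurentDeriv δ C) (-1) := by
  intro j hj
  rw [xCoeff_laurentDeriv]
  rcases lt_trichotomy j 1 with h | rfl | h
  · obtain rfl : j = 0 := by omega
    rw [hC.coeff_zero, map_zero]
  · rw [hC.coeff_one, Derivation.map_one_eq_zero]
  · rw [hC.coeff_of_one_lt j h, map_zero]

theorem IsSolutionWithPair.polyToLaurent_polyDeriv (h : IsSolutionWithPair n m lam f C P Q)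
    (δ : Derivation ℤ M M) :
    polyToLaurent (polyDeriv δ P) = n • (C ^ (n - 1) * laurentDeriv δ C) := by
  rw [← laurentDeriv_polyToLaurent, h.eq_pow, Derivation.leibniz_pow, smul_eq_mul]

theorem IsSolutionWithPair.natDegree_polyDeriv (h : IsSolutionWithPair n m lam f C P Q)
    (hn : 2 ≤ n) (δ : Derivation ℤ M M) : (polyDeriv δ P).natDegree ≤ n - 2 := by
  rw [← hasDegLE_polyToLaurent_iff, h.polyToLaurent_polyDeriv δ, ← Nat.cast_smul_eq_nsmul M]
  refine (((h.normalized.hasDegLE.pow _).mul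
    (HasDegLE.laurentDeriv_of_isNormalized h.normalized δ)).mono ?_).smul _
  omega

/-- The vanishing of the Jacobian of `(P, Q)` with respect to `x` and to a derivation of the
coefficients which kills the data of the system. -/
theorem IsSolutionWithPair.jacobian_eq_zero (h : IsSolutionWithPair n m lam f C P Q)
    (hn : 2 ≤ n) (δ : Derivation ℤ M M) (hK : ∀ a : K, δ (algebraMap K M a) = 0)
    (hf : δ f = 0) : polyDeriv δ P * derivative Q = derivative P * polyDeriv δ Q := by
  obtain ⟨F, hF, hFf, hQ⟩ := h.eq_sum
  rw [← lamSum] at hQ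
  set S₁ := ∑ i ∈ Finset.range (m + n - 1),
      algebraMap K M (lam i) • ((m - i : ℤ) • C ^ ((m : ℤ) - i - 1))
  have hD : laurentDeriv δ (lamSum n m lam C) = S₁ * laurentDeriv δ C :=
    derivation_lamSum _ fun a U => laurent_ext fun k => by
      rw [xCoeff_smul, xCoeff_laurentDeriv, xCoeff_laurentDeriv, xCoeff_smul, Derivation.leibniz,
        hK, smul_zero, add_zero, smul_eq_mul]
  have hE : laurentEuler M (lamSum n m lam C) = S₁ * laurentEuler M C :=
    derivation_lamSum _ fun a U => laurent_ext fun k => by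
      rw [xCoeff_smul, xCoeff_laurentEuler, xCoeff_laurentEuler, xCoeff_smul, mul_left_comm]
  have hFd : HasDegLE F (1 - n) := hF
  have hFδ : HasDegLE (laurentDeriv δ F) (-n) := fun j hj => by
    rw [xCoeff_laurentDeriv]
    rcases eq_or_ne j (1 - n) with rfl | hne
    · rw [hFf, hf]
    · rw [hF j (by omega), map_zero]
  have hCδ := HasDegLE.laurentDeriv_of_isNormalized h.normalized δ
  -- Both derivations multiply the `λ`-sum by the same factor `S₁`, so its contributions cancel and
  -- only `F` remains.
  have key : polyToLaurent (X * (polyDeriv δ P * derivative Q - derivative P * polyDeriv δ Q)) =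
      (n : M) • (C ^ (n - 1) * (laurentDeriv δ C * laurentEuler M F -
        laurentEuler M C * laurentDeriv δ F)) := by
    have e1 : polyToLaurent (X * (polyDeriv δ P * derivative Q - derivative P * polyDeriv δ Q)) =
        polyToLaurent (polyDeriv δ P) * polyToLaurent (X * derivative Q) -
        polyToLaurent (X * derivative P) * polyToLaurent (polyDeriv δ Q) := by
      rw [← map_mul, ← map_mul, ← map_sub]
      congr 1
      ring
    rw [e1, ← laurentDeriv_polyToLaurent, ← laurentDeriv_polyToLaurent,
      ← laurentEuler_polyToLaurent, ← laurentEuler_polyToLaurent, hQ, h.eq_pow, map_add, map_add,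
      hD, hE, Derivation.leibniz_pow, Derivation.leibniz_pow, Nat.cast_smul_eq_nsmul,
      nsmul_eq_mul, nsmul_eq_mul, nsmul_eq_mul, smul_eq_mul, smul_eq_mul]
    ring
  -- Here `δC` has degree `≤ -1`, and `δF` has degree `≤ -n` since `δ f = 0`. The bound is thus `(n
  -- - 1) + (1 - n) = 0`, and a multiple of `X` of degree at most `0` is zero.
  have hdeg : HasDegLE (polyToLaurent
      (X * (polyDeriv δ P * derivative Q - derivative P * polyDeriv δ Q))) (0 : ℕ) := by
    rw [key]
    refine HasDegLE.smul _ (((h.normalized.hasDegLE.pow (n - 1)).mul (b := 1 - n)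
      (HasDegLE.sub ?_ ?_)).mono (by omega))
    · exact (hCδ.mul hFd.laurentEuler).mono (by omega)
    · exact (h.normalized.hasDegLE.laurentEuler.mul hFδ).mono (by omega)
  rw [hasDegLE_polyToLaurent_iff] at hdeg
  by_contra hne
  rw [natDegree_X_mul (sub_ne_zero.2 hne)] at hdeg
  omega

/-- From `δP = n C ^ (n - 1) δC` in a field of Laurent series of characteristic zero. -/
theorem IsSolutionWithPair.derivation_eq_zero [CharZero M]
    (h : IsSolutionWithPair n m lam f C P Q) (hn : 2 ≤ n) (δ : Derivation ℤ M M)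
    (hP : polyDeriv δ P = 0) (k : ℤ) : δ (xCoeff C k) = 0 := by
  have hn0 : (n : M) ≠ 0 := by simp; omega
  have hC0 : C ≠ 0 := h.normalized.isUnit.ne_zero
  have e := h.polyToLaurent_polyDeriv δ
  rw [hP, map_zero, ← Nat.cast_smul_eq_nsmul M, eq_comm, smul_eq_zero, or_iff_right hn0,
    mul_eq_zero, or_iff_right (pow_ne_zero _ hC0)] at e
  rw [← xCoeff_laurentDeriv, e, xCoeff_zero]

theorem IsSolutionWithPair.natDegree_derivative [CharZero M]
    (h : IsSolutionWithPair n m lam f C P Q) : (derivative P).natDegree = n - 1 := by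
  rw [Polynomial.natDegree_derivative, h.natDegree]

theorem IsSolutionWithPair.polyDeriv_eq_zero_of_isCoprime [CharZero M]
    (h : IsSolutionWithPair n m lam f C P Q)
    (hn : 2 ≤ n) (δ : Derivation ℤ M M) (hK : ∀ a : K, δ (algebraMap K M a) = 0)
    (hf : δ f = 0) (hco : IsCoprime (derivative P) (derivative Q)) : polyDeriv δ P = 0 := by
  have hdvd : derivative P ∣ polyDeriv δ P :=
    hco.dvd_of_dvd_mul_right ⟨_, h.jacobian_eq_zero hn δ hK hf⟩
  refine eq_zero_of_dvd_of_natDegree_lt hdvd ?_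
  rw [h.natDegree_derivative]
  have := h.natDegree_polyDeriv hn δ
  omega

end Jacobian

/-! ### Compositional inverses, twists by roots of unity, and `x` as a fraction in `P` and `Q`. -/

section CompositionalInverse

variable {M : Type*} [Field M]

theorem xCoeff_ofPowerSeries_zero (a : PowerSeries M) :
    xCoeff (HahnSeries.ofPowerSeries ℤ M a) 0 = PowerSeries.constantCoeff a := by
  simpa using xCoeff_ofPowerSeries_neg a 0

theorem xMonomial_one_zpow (k : ℤ) : xMonomial 1 (1 : M) ^ k = xMonomial k 1 := by
  rw [xMonomial, xMonomial, RatFunc.single_zpow, RatFunc.single_zpow (-k), ← zpow_mul,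
    neg_one_mul]

/-- The substitution of a power series with a compositional inverse, extended to Laurent series. -/
theorem exists_laurentSubst (p : PowerSeries M) (h0 : PowerSeries.constantCoeff p = 0)
    (h1 : PowerSeries.coeff 1 p = 1) :
    ∃ (φ : PowerSeries M →ₐ[M] PowerSeries M) (σ : LaurentSeries M →+* LaurentSeries M),
      φ p = PowerSeries.X ∧
      (∀ a, PowerSeries.constantCoeff (φ a) = PowerSeries.constantCoeff a) ∧
      ∀ a, σ (HahnSeries.ofPowerSeries ℤ M a) = HahnSeries.ofPowerSeries ℤ M (φ a) := by
  have hu : IsUnit (PowerSeries.coeff 1 p) := h1 ▸ isUnit_one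
  set q := p.substInvOfIsUnit hu with hq
  have hqs : PowerSeries.HasSubst q := PowerSeries.HasSubst.substInvOfIsUnit p hu
  have hps : PowerSeries.HasSubst p := PowerSeries.HasSubst.of_constantCoeff_zero h0
  have hq0 : PowerSeries.constantCoeff q = 0 := by simp [hq]
  set φ : PowerSeries M →ₐ[M] PowerSeries M := PowerSeries.substAlgHom hqs with hφ
  have hφs : ∀ a, φ a = PowerSeries.subst q a := fun a => by
    rw [hφ, PowerSeries.coe_substAlgHom]
  -- Substituting `p` undoes substituting `q`; injectivity is what lets `φ` extend to the fraction
  -- field.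
  have hinj : Function.Injective φ := by
    refine Function.LeftInverse.injective (g := PowerSeries.subst p) fun a => ?_
    rw [hφs, PowerSeries.subst_comp_subst_apply hqs hps,
      PowerSeries.subst_substInvOfIsUnit_left p h0 hu]
    exact PowerSeries.X_subst a
  have hinj' : Function.Injective
      ((HahnSeries.ofPowerSeries ℤ M).comp (φ : PowerSeries M →+* PowerSeries M)) :=
    HahnSeries.ofPowerSeries_injective.comp hinj
  refine ⟨φ, IsFractionRing.lift hinj', ?_, fun a => ?_, fun a => ?_⟩
  · rw [hφs]
    exact PowerSeries.subst_substInvOfIsUnit_right p h0 hu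
  · have h : PowerSeries.constantCoeff (φ (a - PowerSeries.C (PowerSeries.constantCoeff a))) = 0 := by
      rw [hφs]
      exact PowerSeries.constantCoeff_subst_eq_zero hq0 _ (by simp)
    rw [map_sub, map_sub, sub_eq_zero] at h
    rw [h]
    have hc : φ (PowerSeries.C (PowerSeries.constantCoeff a)) =
        PowerSeries.C (PowerSeries.constantCoeff a) := φ.commutes _
    rw [hc, PowerSeries.constantCoeff_C]
  · exact IsFractionRing.lift_algebraMap hinj' a

/-- A normalized series admits a compositional inverse: there is an endomorphism of the ring of
Laurent series which sends it to `x` and preserves leading terms. -/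
theorem IsNormalized.exists_inverse {C : LaurentSeries M} (hC : IsNormalized C) :
    ∃ σ : LaurentSeries M →+* LaurentSeries M, σ C = xMonomial 1 1 ∧
      (∀ c, σ (xMonomial 0 c) = xMonomial 0 c) ∧
      ∀ H k, HasDegLE H k → HasDegLE (σ H) k ∧ xCoeff (σ H) k = xCoeff H k := by
  have hC0 : C ≠ 0 := hC.isUnit.ne_zero
  have hzpow : ∀ k : ℤ, HasDegLE (C ^ k) k := fun k => by
    rw [← laurentZPow_eq_zpow]
    exact hC.hasDegLE_laurentZPow k
  have hzpow1 : ∀ k : ℤ, xCoeff (C ^ k) k = 1 := fun k => by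
    rw [← laurentZPow_eq_zpow]
    exact hC.xCoeff_laurentZPow k
  -- The series inverted is `C⁻¹ = x⁻¹ + ⋯`, a power series in the formal variable `x⁻¹`. Sending it
  -- to `x⁻¹` sends `C` to `x`.
  obtain ⟨p, hp⟩ := ((hzpow (-1)).mono (by omega : (-1 : ℤ) ≤ 0)).exists_powerSeries
  obtain ⟨φ, σ, hφp, hφ0, hσ⟩ := exists_laurentSubst p
    (by rw [← xCoeff_ofPowerSeries_zero, hp]; exact hzpow (-1) 0 (by omega))
    (by rw [← xCoeff_ofPowerSeries_neg, hp]; exact hzpow1 (-1))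
  have hσC : σ C = xMonomial 1 1 := by
    have h := hσ p
    rw [hp, hφp, HahnSeries.ofPowerSeries_X, map_zpow₀, zpow_neg_one] at h
    rw [← inv_inv (σ C), h, ← zpow_neg_one, ← RatFunc.single_zpow]
    rfl
  refine ⟨σ, hσC, fun c => ?_, fun H k hH => ?_⟩
  · have h : xMonomial 0 c = HahnSeries.ofPowerSeries ℤ M (PowerSeries.C c) := by
      rw [HahnSeries.ofPowerSeries_C]
      rfl
    rw [h, hσ]
    congr 1
    exact φ.commutes c
  · obtain ⟨a, ha⟩ := (((hzpow (-k)).mul hH).mono (by omega : -k + k ≤ 0)).exists_powerSeries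
    have hH' : H = C ^ k * HahnSeries.ofPowerSeries ℤ M a := by
      rw [ha, ← mul_assoc, ← zpow_add₀ hC0, add_neg_cancel, zpow_zero, one_mul]
    have hx : σ (C ^ k) = xMonomial k 1 := by
      rw [map_zpow₀, hσC, xMonomial_one_zpow]
    have hd := (HasDegLE.xMonomial k (1 : M)).mul (hasDegLE_ofPowerSeries (φ a))
    have hc := (HasDegLE.xMonomial k (1 : M)).xCoeff_mul (hasDegLE_ofPowerSeries (φ a))
    have hc' := (hzpow k).xCoeff_mul (hasDegLE_ofPowerSeries a)
    rw [add_zero, xCoeff_ofPowerSeries_zero] at hc hc'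
    rw [add_zero] at hd
    rw [hH', map_mul, hσ, hx]
    refine ⟨hd, ?_⟩
    rw [hc, hc', hφ0, hzpow1, xCoeff_xMonomial, if_pos rfl]

end CompositionalInverse

section Twist

variable {M : Type*} [Field M]

/-- The substitution `x ↦ ζ x` in Laurent series. -/
def laurentTwist (ζ : M) (hζ : ζ ≠ 0) : LaurentSeries M →+* LaurentSeries M where
  toFun := laurentAddHom fun k => AddMonoidHom.mulLeft (ζ ^ (-k))
  map_zero' := map_zero _
  map_add' := map_add _
  map_one' := by
    ext k
    rcases eq_or_ne k 0 with rfl | hk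
    · simp
    · simp [HahnSeries.coeff_one, hk]
  map_mul' U V := by
    ext k
    rw [coeff_laurentAddHom, HahnSeries.coeff_mul, map_sum, HahnSeries.coeff_mul]
    refine Finset.sum_congr ?_ fun p hp => ?_
    · ext p
      simp [zpow_ne_zero, hζ]
    · rw [Finset.mem_antidiagonal] at hp
      rw [← hp.2.2, coeff_laurentAddHom, coeff_laurentAddHom]
      simp only [AddMonoidHom.coe_mulLeft]
      rw [neg_add, zpow_add₀ hζ]
      ring

@[simp] theorem xCoeff_laurentTwist (ζ : M) (hζ : ζ ≠ 0) (U : LaurentSeries M) (k : ℤ) :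
    xCoeff (laurentTwist ζ hζ U) k = ζ ^ k * xCoeff U k := by
  change ζ ^ (- -k) * _ = _
  rw [neg_neg]
  rfl

end Twist

section Generation

theorem algebraMap_laurentSeries {M : Type*} [Field M] (c : M) : algebraMap M (LaurentSeries M) c = xMonomial 0 c := by
  rw [LaurentSeries.algebraMap_apply]
  rfl

variable {K M : Type*} [Field K] [Field M] [CharZero M] [Algebra K M]
  {n m : ℕ} {lam : ℕ → K} {f : M} {C : LaurentSeries M} {P Q : M[X]}

/-- If `p` splits and `y` is the only common root of `p` and `q`, then `y` is rational. -/
theorem mem_range_of_unique_common_root {E Λ : Type*} [Field E] [CharZero E] [Field Λ]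
    [Algebra E Λ] {y : Λ} {p q : E[X]} (hp : p ≠ 0) (hsplit : (p.map (algebraMap E Λ)).Splits)
    (hpy : aeval y p = 0) (hqy : aeval y q = 0)
    (huniq : ∀ r : Λ, aeval r p = 0 → aeval r q = 0 → r = y) :
    y ∈ (algebraMap E Λ).range := by
  have hint : IsIntegral E y := IsAlgebraic.isIntegral ⟨p, hp, hpy⟩
  have hmp : minpoly E y ∣ p := minpoly.dvd E y hpy
  have hmq : minpoly E y ∣ q := minpoly.dvd E y hqy
  have hsep : (minpoly E y).Separable := (minpoly.irreducible hint).separable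
  have hms : ((minpoly E y).map (algebraMap E Λ)).Splits :=
    hsplit.of_dvd (by rwa [Polynomial.map_ne_zero_iff (algebraMap E Λ).injective])
      (Polynomial.map_dvd _ hmp)
  have hcard := hms.natDegree_eq_card_roots
  -- The minimal polynomial divides `p` and `q`, so all its roots are common roots. It is separable
  -- and splits, so a single root means degree one.
  have hle : ((minpoly E y).map (algebraMap E Λ)).roots ≤ {y} := by
    rw [Multiset.le_iff_subset (nodup_roots hsep.map)]
    intro r hr
    rw [mem_roots', IsRoot.def, eval_map_algebraMap] at hr
    rw [Multiset.mem_singleton]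
    refine huniq r ?_ ?_
    · obtain ⟨a, ha⟩ := hmp
      rw [ha, map_mul, hr.2, zero_mul]
    · obtain ⟨a, ha⟩ := hmq
      rw [ha, map_mul, hr.2, zero_mul]
  have h1 : (minpoly E y).natDegree = 1 := by
    refine le_antisymm ?_ (minpoly.natDegree_pos hint)
    rw [natDegree_map] at hcard
    rw [hcard]
    simpa using Multiset.card_le_card hle
  exact minpoly.natDegree_eq_one_iff.1 h1

/-- If `f ≠ 0`, then `x` is a quotient of two polynomials in `P` and `Q`. -/
theorem IsSolutionWithPair.exists_mul_eq (h : IsSolutionWithPair n m lam f C P Q) (hn : 2 ≤ n)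
    (hf : f ≠ 0) {ζ : M} (hζ : IsPrimitiveRoot ζ n) :
    ∃ r ∈ Algebra.adjoin M {P, Q}, ∃ s ∈ Algebra.adjoin M {P, Q}, s ≠ 0 ∧ X * s = r := by
  obtain ⟨σ, hσC, hσc, hσd⟩ := h.normalized.exists_inverse
  have hx : HasDegLE (polyToLaurent (X : M[X])) 1 := by
    rw [polyToLaurent_X]; exact HasDegLE.xMonomial 1 1
  set y := σ (polyToLaurent X) with hy
  have hy1 : xCoeff y 1 = 1 := by
    rw [(hσd _ _ hx).2, polyToLaurent_X, xCoeff_xMonomial, if_pos rfl]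
  have hy0 : y ≠ 0 := by
    rintro h0
    rw [h0] at hy1
    simp at hy1
  have hι : ∀ G : M[X], aeval y G = σ (polyToLaurent G) := by
    intro G
    induction G using Polynomial.induction_on' with
    | add p q hp hq => simp [hp, hq]
    | monomial k a =>
      rw [aeval_monomial, algebraMap_laurentSeries, ← C_mul_X_pow_eq_monomial, map_mul, map_mul,
        polyToLaurent_C, hσc, map_pow, map_pow]
  have hιinj : Function.Injective (aeval y : M[X] →ₐ[M] LaurentSeries M) := by
    intro p q hpq
    rw [hι, hι] at hpq
    exact polyToLaurent_injective (σ.injective hpq)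
  have hιP : aeval y P = xMonomial n 1 := by
    rw [hι, h.eq_pow, map_pow, hσC, xMonomial_pow, one_pow, mul_one]
  -- The powers `C ^ (m - i)` become `x ^ (m - i)` with `m - i ≥ 2 - n`, so only `F` contributes in
  -- degree `1 - n`.
  have hιQ : xCoeff (aeval y Q) (1 - n) = f := by
    obtain ⟨F, hF, hFf, hQ⟩ := h.eq_sum
    rw [hι, hQ, map_add, map_sum, xCoeff_add, (hσd F (1 - n) hF).2, hFf, xCoeff_sum,
      Finset.sum_eq_zero, zero_add]
    intro i hi
    rw [Finset.mem_range] at hi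
    have e : ∀ (a : M) (U : LaurentSeries M), σ (a • U) = a • σ U := fun a U => by
      rw [← HahnSeries.C_mul_eq_smul, ← HahnSeries.C_mul_eq_smul, map_mul]
      congr 1
      exact hσc a
    rw [e, laurentZPow_eq_zpow, map_zpow₀, hσC, xMonomial_one_zpow, xCoeff_smul, xCoeff_xMonomial,
      if_neg (by omega), mul_zero]
  have hζ0 : ζ ≠ 0 := hζ.ne_zero (by omega)
  have hζn : ∀ i : ℕ, (ζ ^ i) ^ n = 1 := fun i => by rw [pow_right_comm, hζ.pow_eq_one, one_pow]
  let τ : ℕ → LaurentSeries M →ₐ[M] LaurentSeries M := fun i =>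
    { laurentTwist (ζ ^ i) (pow_ne_zero i hζ0) with
      commutes' := fun c => laurent_ext fun k => by
        change xCoeff (laurentTwist (ζ ^ i) (pow_ne_zero i hζ0) _) k = _
        rw [xCoeff_laurentTwist, algebraMap_laurentSeries, xCoeff_xMonomial]
        split_ifs with hk
        · rw [hk, zpow_zero, one_mul]
        · rw [mul_zero] }
  have hτ : ∀ i U k, xCoeff (τ i U) k = (ζ ^ i) ^ k * xCoeff U k := fun i U k =>
    xCoeff_laurentTwist _ (pow_ne_zero i hζ0) U k
  have hτP : ∀ i, aeval (τ i y) P = xMonomial n 1 := fun i => by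
    rw [aeval_algHom_apply, hιP]
    refine laurent_ext fun k => ?_
    rw [hτ, xCoeff_xMonomial]
    split_ifs with hk
    · rw [hk, zpow_natCast, hζn, one_mul]
    · rw [mul_zero]
  set E := IntermediateField.adjoin M {aeval y P, aeval y Q} with hE
  have hPE : aeval y P ∈ E := IntermediateField.subset_adjoin _ _ (by simp)
  have hQE : aeval y Q ∈ E := IntermediateField.subset_adjoin _ _ (by simp)
  set p : E[X] := P.map (algebraMap M E) - Polynomial.C ⟨_, hPE⟩ with hp
  set q : E[X] := Q.map (algebraMap M E) - Polynomial.C ⟨_, hQE⟩ with hq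
  have hpr : ∀ r : LaurentSeries M, aeval r p = aeval r P - aeval y P := fun r => by
    rw [hp, map_sub, aeval_map_algebraMap, aeval_C]
    rfl
  have hqr : ∀ r : LaurentSeries M, aeval r q = aeval r Q - aeval y Q := fun r => by
    rw [hq, map_sub, aeval_map_algebraMap, aeval_C]
    rfl
  have hpdeg : p.natDegree = n := by
    rw [hp, natDegree_sub_C, natDegree_map, h.natDegree]
  have hp0 : p ≠ 0 := by
    rintro h0
    rw [h0, natDegree_zero] at hpdeg
    omega
  set p' := p.map (algebraMap E (LaurentSeries M)) with hp'
  have hp'0 : p' ≠ 0 := by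
    rwa [hp', Polynomial.map_ne_zero_iff (algebraMap E (LaurentSeries M)).injective]
  have hp'deg : p'.natDegree = n := by rw [hp', natDegree_map, hpdeg]
  classical
  set S : Finset (LaurentSeries M) := (Finset.range n).image fun i => τ i y with hS
  -- The twists of `y` have distinct leading coefficients `ζ ^ i`, so they exhaust the roots of the
  -- degree `n` polynomial `P(T) - x ^ n`.
  have hScard : S.card = n := by
    rw [hS, Finset.card_image_of_injOn, Finset.card_range]
    intro i hi j hj hij
    have e := congrArg (fun U => xCoeff U 1) hij
    simp only [hτ, hy1, zpow_one, mul_one] at e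
    exact hζ.pow_inj (Finset.mem_range.1 hi) (Finset.mem_range.1 hj) e
  have hSroots : S ⊆ p'.roots.toFinset := by
    intro r hr
    rw [hS, Finset.mem_image] at hr
    obtain ⟨i, -, rfl⟩ := hr
    rw [Multiset.mem_toFinset, mem_roots', IsRoot.def, hp', eval_map_algebraMap, hpr, hτP, hιP,
      sub_self]
    exact ⟨hp'0, rfl⟩
  have hc1 : p'.roots.toFinset.card ≤ p'.roots.card := Multiset.toFinset_card_le _
  have hc2 : p'.roots.card ≤ n := hp'deg ▸ card_roots' p'
  have hc3 := Finset.card_le_card hSroots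
  have hSeq : S = p'.roots.toFinset := Finset.eq_of_subset_of_card_le hSroots (by omega)
  have hsplit : p'.Splits := splits_iff_card_roots.2 (by omega)
  have hmem := mem_range_of_unique_common_root (E := E) (y := y) (q := q) hp0 hsplit
    (by rw [hpr, sub_self]) (by rw [hqr, sub_self]) (by
      intro r hr1 hr2
      have hrS : r ∈ S := by
        rw [hSeq, Multiset.mem_toFinset, mem_roots', IsRoot.def, hp', eval_map_algebraMap]
        exact ⟨hp'0, hr1⟩
      rw [hS, Finset.mem_image] at hrS
      obtain ⟨i, hi, rfl⟩ := hrS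
      rw [hqr, sub_eq_zero, aeval_algHom_apply] at hr2
      -- Comparing coefficients gives `ζ ^ (i (1 - n)) f = f`. As `ζ ^ n = 1` and `f ≠ 0`, this says
      -- `ζ ^ i = 1`, so the twist is trivial.
      have e := congrArg (fun U => xCoeff U (1 - (n : ℤ))) hr2
      simp only [hτ, hιQ] at e
      rw [mul_eq_right₀ hf, zpow_sub₀ (pow_ne_zero i hζ0), zpow_natCast, hζn, div_one,
        zpow_one] at e
      refine laurent_ext fun k => ?_
      rw [hτ, e, one_zpow, one_mul])
  obtain ⟨⟨y', hyE⟩, hyy⟩ := hmem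
  change y' = y at hyy
  subst hyy
  rw [hE, IntermediateField.mem_adjoin_iff_div] at hyE
  have himg : (Algebra.adjoin M {aeval y P, aeval y Q} : Subalgebra M (LaurentSeries M)) =
      (Algebra.adjoin M {P, Q}).map (aeval y : M[X] →ₐ[M] LaurentSeries M) := by
    rw [AlgHom.map_adjoin, Set.image_pair]
  rw [himg] at hyE
  obtain ⟨_, ⟨r, hr, rfl⟩, _, ⟨s, hs, rfl⟩, hrs⟩ := hyE
  have hs0 : aeval y s ≠ 0 := by
    intro h0
    apply hy0
    rw [hrs]
    change _ / aeval y s = 0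
    rw [h0, div_zero]
  refine ⟨r, hr, s, hs, ?_, ?_⟩
  · rintro rfl
    exact hs0 (map_zero _)
  · apply hιinj
    rw [map_mul, aeval_X]
    exact (eq_div_iff hs0).1 hrs

end Generation

/-! ### Multiplicities along a pole of a vector field, and rigidity when `f ≠ 0`. -/

section Multiplicity

variable {M : Type*} [Field M]

theorem pow_mul_eq_pow_mul_of_not_dvd {A : Type*} [CommRing A] [IsDomain A] {π v w : A}
    (hπ : π ≠ 0) (hv : ¬ π ∣ v) (hw : ¬ π ∣ w) {a b : ℕ} (h : π ^ a * v = π ^ b * w) :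
    a = b := by
  wlog hab : a < b generalizing a b v w
  · rcases lt_trichotomy a b with h1 | h1 | h1
    · exact absurd h1 hab
    · exact h1
    · exact (this hw hv h.symm h1).symm
  obtain ⟨c, rfl⟩ := Nat.exists_eq_add_of_lt hab
  exfalso
  apply hv
  rw [add_assoc, pow_add, mul_assoc] at h
  rw [mul_left_cancel₀ (pow_ne_zero a hπ) h, pow_succ', mul_assoc]
  exact dvd_mul_right _ _

theorem Polynomial.exists_eq_pow_mul_not_dvd {π h : M[X]} (hπ : Irreducible π) (hh : h ≠ 0) :
    ∃ (j : ℕ) (u : M[X]), h = π ^ j * u ∧ ¬ π ∣ u := by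
  obtain ⟨u, hu, hd⟩ := (FiniteMultiplicity.of_not_isUnit hπ.not_isUnit hh).exists_eq_pow_mul_and_not_dvd
  exact ⟨_, u, hu, hd⟩

theorem Polynomial.exists_isCoprime_factors {p : M[X]} (hp : p ≠ 0) (q : M[X]) :
    ∃ d g t : M[X], IsCoprime g t ∧ p = d * g ∧ q = d * t := by
  classical
  obtain ⟨g, hg⟩ := EuclideanDomain.gcd_dvd_left p q
  obtain ⟨t, ht⟩ := EuclideanDomain.gcd_dvd_right p q
  have hd : EuclideanDomain.gcd p q ≠ 0 := fun h0 => hp (EuclideanDomain.gcd_eq_zero_iff.1 h0).1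
  refine ⟨_, g, t, ⟨EuclideanDomain.gcdA p q, EuclideanDomain.gcdB p q, ?_⟩, hg, ht⟩
  apply mul_left_cancel₀ hd
  have e := EuclideanDomain.gcd_eq_gcd_ab p q
  generalize EuclideanDomain.gcdA p q = a at *
  generalize EuclideanDomain.gcdB p q = b at *
  generalize EuclideanDomain.gcd p q = d at *
  rw [mul_one]
  calc d * (a * g + b * t) = (d * g) * a + (d * t) * b := by ring
    _ = p * a + q * b := by rw [← hg, ← ht]
    _ = d := e.symm

/-- The denominators in a subalgebra over which `X` is a fraction. -/
theorem exists_mul_mem_of_X_mul_mem {A : Subalgebra M M[X]} {s : M[X]} (hs : s ∈ A) (hs0 : s ≠ 0)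
    (hX : X * s ∈ A) (G : M[X]) : ∃ b ∈ A, b ≠ 0 ∧ G * b ∈ A := by
  induction G using Polynomial.induction_on with
  | C a => exact ⟨1, A.one_mem, one_ne_zero, by rw [mul_one]; exact A.algebraMap_mem a⟩
  | add p q hp hq =>
    obtain ⟨b, hb, hb0, hpb⟩ := hp
    obtain ⟨c, hc, hc0, hqc⟩ := hq
    refine ⟨b * c, A.mul_mem hb hc, mul_ne_zero hb0 hc0, ?_⟩
    have e : (p + q) * (b * c) = (p * b) * c + (q * c) * b := by ring
    rw [e]
    exact A.add_mem (A.mul_mem hpb hc) (A.mul_mem hqc hb)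
  | monomial k a hk =>
    obtain ⟨b, hb, hb0, hpb⟩ := hk
    refine ⟨b * s, A.mul_mem hb hs, mul_ne_zero hb0 hs0, ?_⟩
    have e : C a * X ^ (k + 1) * (b * s) = (C a * X ^ k * b) * (X * s) := by ring
    rw [e]
    exact A.mul_mem hpb hX

variable [CharZero M]

/-- A pole of order `e` of a rational vector field `δ - (s / g) ∂ₓ` which stabilizes a subalgebra
forces the multiplicities of the elements of the subalgebra to be divisible by `e + 1`. -/
theorem dvd_multiplicity_of_stable (δ : Derivation ℤ M M) {A : Subalgebra M M[X]} {g s π : M[X]}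
    (hA : ∀ h ∈ A, ∃ h' ∈ A, g * polyDeriv δ h - s * derivative h = g * h')
    (hπ : Irreducible π) {e : ℕ} {g₀ : M[X]} (hg : g = π ^ e * g₀) (hg₀ : ¬ π ∣ g₀) (he : e ≠ 0)
    (hs : ¬ π ∣ s) (j : ℕ) : ∀ u, ¬ π ∣ u → π ^ j * u ∈ A → e + 1 ∣ j := by
  have hp := hπ.prime
  have hπg : π ∣ g := hg ▸ (dvd_pow_self π he).mul_right _
  have hder : ¬ π ∣ derivative π := fun hd => by
    have h0 := eq_zero_of_dvd_of_natDegree_lt hd (natDegree_derivative_lt hπ.natDegree_pos.ne')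
    have h1 := derivative_eq_zero.1 h0
    have h2 := hπ.natDegree_pos
    omega
  have hflow : ¬ π ∣ g * polyDeriv δ π - s * derivative π := fun hd => by
    rw [dvd_sub_right (hπg.mul_right _), hp.dvd_mul] at hd
    exact hd.elim hs hder
  induction j using Nat.strong_induction_on with
  | _ j ih =>
    intro u hu hmem
    rcases Nat.eq_zero_or_pos j with rfl | hj
    · exact dvd_zero _
    obtain ⟨j, rfl⟩ := Nat.exists_eq_succ_of_ne_zero hj.ne'
    obtain ⟨h', hh', heq⟩ := hA _ hmem
    -- Applying `g δ - s ∂ₓ` to `π ^ (j+1) u` gives `π ^ j w`, and `w` is prime to `π` because `π ∣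
    -- g` while `π` divides neither `s` nor `π'`. Comparing with `g h' = π ^ e g₀ h'`, the
    -- multiplicity of `h'` is `(j + 1) - (e + 1)`, to which induction applies.
    set w := C ((j + 1 : ℕ) : M) * u * (g * polyDeriv δ π - s * derivative π) +
      π * (g * polyDeriv δ u - s * derivative u) with hw
    have hwd : ¬ π ∣ w := fun hd => by
      rw [hw, dvd_add_left (dvd_mul_right _ _), hp.dvd_mul, hp.dvd_mul] at hd
      rcases hd with (hd | hd) | hd
      · exact hp.not_isUnit (isUnit_of_dvd_unit hd
          (isUnit_C.2 (IsUnit.mk0 _ (Nat.cast_ne_zero.2 (Nat.succ_ne_zero j)))))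
      · exact hu hd
      · exact hflow hd
    have hcalc : π ^ j * w = π ^ e * (g₀ * h') := by
      rw [← mul_assoc, ← hg, ← heq, Derivation.leibniz, Derivation.leibniz_pow, derivative_mul,
        derivative_pow, hw]
      simp only [Nat.succ_eq_add_one, Nat.add_sub_cancel, smul_eq_mul, nsmul_eq_mul, map_natCast]
      push_cast
      ring
    have hh0 : h' ≠ 0 := by
      rintro rfl
      rw [mul_zero, mul_zero, mul_eq_zero, or_iff_right (pow_ne_zero _ hπ.ne_zero)] at hcalc
      exact hwd (hcalc ▸ dvd_zero _)
    obtain ⟨k, u', rfl, hu'⟩ := Polynomial.exists_eq_pow_mul_not_dvd hπ hh0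
    have hjk : j = e + k := by
      refine pow_mul_eq_pow_mul_of_not_dvd hπ.ne_zero hwd (w := g₀ * u') ?_ ?_
      · rw [hp.dvd_mul, not_or]
        exact ⟨hg₀, hu'⟩
      · rw [hcalc, pow_add]
        ring
    have h1 := ih k (by omega) u' hu' hh'
    have h2 : j.succ = k + (e + 1) := by omega
    rw [h2]
    exact (Nat.dvd_add_left (dvd_refl _)).2 h1

theorem polyDeriv_eq_zero_of_fraction (δ : Derivation ℤ M M) {P Q : M[X]}
    (hjac : polyDeriv δ P * derivative Q = derivative P * polyDeriv δ Q)
    (hdeg : (polyDeriv δ P).natDegree < (derivative P).natDegree) {s : M[X]}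
    (hs : s ∈ Algebra.adjoin M {P, Q}) (hs0 : s ≠ 0) (hX : X * s ∈ Algebra.adjoin M {P, Q}) :
    polyDeriv δ P = 0 := by
  by_contra hne
  have hP0 : derivative P ≠ 0 := by
    rintro h0
    rw [h0] at hdeg
    simp at hdeg
  obtain ⟨d, g, t, hco, hdg, hdt⟩ : ∃ d g t : M[X], IsCoprime g t ∧ derivative P = d * g ∧
      polyDeriv δ P = d * t :=
    Polynomial.exists_isCoprime_factors hP0 _
  have hd0 : d ≠ 0 := by rintro rfl; simp [hne] at hdt
  have hg0 : g ≠ 0 := by rintro rfl; simp [hP0] at hdg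
  have ht0 : t ≠ 0 := by rintro rfl; simp [hne] at hdt
  -- The reduced fraction `t / g = δP / P'` has `deg t < deg g`, so it has a pole.
  have hgdeg : 0 < g.natDegree := by
    rw [hdg, hdt, natDegree_mul hd0 ht0, natDegree_mul hd0 hg0] at hdeg
    omega
  obtain ⟨π, hπ, hπg⟩ := exists_irreducible_of_natDegree_pos hgdeg
  have hπt : ¬ π ∣ t := fun h => hπ.not_isUnit (hco.isUnit_of_dvd' hπg h)
  obtain ⟨e, g₀, hg, hg₀⟩ := Polynomial.exists_eq_pow_mul_not_dvd hπ hg0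
  have he : e ≠ 0 := by
    rintro rfl
    rw [pow_zero, one_mul] at hg
    exact hg₀ (hg ▸ hπg)
  have hA : ∀ h ∈ Algebra.adjoin M {P, Q}, ∃ h' ∈ Algebra.adjoin M {P, Q},
      g * polyDeriv δ h - t * derivative h = g * h' := by
    intro h hh
    induction hh using Algebra.adjoin_induction with
    | mem x hx =>
      refine ⟨0, zero_mem _, ?_⟩
      rw [mul_zero]
      rcases hx with rfl | hx
      · rw [hdg, hdt]; ring
      · rw [Set.mem_singleton_iff] at hx
        subst hx
        apply mul_left_cancel₀ hd0
        rw [mul_zero, mul_sub, ← mul_assoc, ← mul_assoc, ← hdg, ← hdt, hjac, sub_self]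
    | algebraMap c =>
      refine ⟨algebraMap M M[X] (δ c), Subalgebra.algebraMap_mem _ _, ?_⟩
      have h1 : polyDeriv δ (algebraMap M M[X] c) = algebraMap M M[X] (δ c) := by
        ext k
        rw [coeff_polyDeriv, algebraMap_eq, coeff_C, coeff_C]
        split_ifs <;> simp
      rw [h1, algebraMap_eq, derivative_C, mul_zero, sub_zero]
    | add x y _ _ hx hy =>
      obtain ⟨x', hx', ex⟩ := hx
      obtain ⟨y', hy', ey⟩ := hy
      refine ⟨x' + y', add_mem hx' hy', ?_⟩
      rw [map_add, map_add, mul_add g x', ← ex, ← ey]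
      ring
    | mul x y hxA hyA hx hy =>
      obtain ⟨x', hx', ex⟩ := hx
      obtain ⟨y', hy', ey⟩ := hy
      refine ⟨x' * y + x * y', add_mem (mul_mem hx' hyA) (mul_mem hxA hy'), ?_⟩
      have e1 : g * (x' * y + x * y') = g * x' * y + x * (g * y') := by ring
      rw [e1, ← ex, ← ey, Derivation.leibniz, derivative_mul, smul_eq_mul, smul_eq_mul]
      ring
  have hmult := dvd_multiplicity_of_stable δ hA hπ hg hg₀ he hπt
  -- Both `b` and `π b` lie in the subalgebra. Their multiplicities are consecutive integers, yet
  -- both are divisible by `e + 1 ≥ 2`.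
  obtain ⟨b, hb, hb0, hπb⟩ := exists_mul_mem_of_X_mul_mem hs hs0 hX π
  obtain ⟨j, u, rfl, hu⟩ := Polynomial.exists_eq_pow_mul_not_dvd hπ hb0
  have h1 := hmult j u hu hb
  have h2 := hmult (j + 1) u hu (by rwa [pow_succ', mul_assoc])
  have h3 := (Nat.dvd_add_right h1).1 h2
  have := Nat.le_of_dvd one_pos h3
  omega

end Multiplicity

section Rigidity

variable {K M : Type*} [Field K] [Field M] [CharZero M] [Algebra K M]
  {n m : ℕ} {lam : ℕ → K} {f : M} {C : LaurentSeries M} {P Q : M[X]}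

theorem IsSolutionWithPair.polyDeriv_eq_zero_of_ne_zero (h : IsSolutionWithPair n m lam f C P Q)
    (hn : 2 ≤ n) (δ : Derivation ℤ M M) (hK : ∀ a : K, δ (algebraMap K M a) = 0)
    (hδf : δ f = 0) (hf : f ≠ 0) {ζ : M} (hζ : IsPrimitiveRoot ζ n) : polyDeriv δ P = 0 := by
  obtain ⟨r, hr, s, hs, hs0, rfl⟩ := h.exists_mul_eq hn hf hζ
  refine polyDeriv_eq_zero_of_fraction δ (h.jacobian_eq_zero hn δ hK hδf) ?_ hs hs0 hr
  have := h.natDegree_polyDeriv hn δ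
  rw [h.natDegree_derivative]
  omega

end Rigidity

/-! ### Function fields without derivations. -/

section FunctionFields

variable {L M : Type*} [Field L] [Field M] [Algebra L M]

/-- A finitely generated field extension without derivations is finite. -/
theorem Module.finite_of_derivation_eq_zero [Algebra.EssFiniteType L M]
    (h : ∀ (D : Derivation L M M) (x : M), D x = 0) : Module.Finite L M := by
  have hsub : Subsingleton (KaehlerDifferential L M) := by
    refine ⟨fun a b => ?_⟩
    rw [← sub_eq_zero, ← Module.forall_dual_apply_eq_zero_iff M]
    intro φ
    have hφ : φ = 0 := by
      apply (KaehlerDifferential.linearMapEquivDerivation L M).injective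
      ext x
      simpa using h (KaehlerDifferential.linearMapEquivDerivation L M φ) x
    rw [hφ, LinearMap.zero_apply]
  have : Algebra.FormallyUnramified L M := ⟨hsub⟩
  exact Algebra.FormallyUnramified.finite_of_free L M

/-- A relative derivation as an absolute derivation. -/
def Derivation.toInt (D : Derivation L M M) : Derivation ℤ M M := D.restrictScalars ℤ

/-- A derivation of a fraction field vanishing on generators of the subring is zero. -/
theorem Derivation.eq_zero_of_fractionRing {B : Type*} [CommRing B] [Algebra B M]
    [IsFractionRing B M] [Algebra L B] [IsScalarTower L B M] {s : Set B}
    (hs : Algebra.adjoin L s = ⊤) (D : Derivation L M M)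
    (h : ∀ b ∈ s, D (algebraMap B M b) = 0) (x : M) : D x = 0 := by
  have hB : ∀ b : B, D (algebraMap B M b) = 0 := by
    intro b
    have hb : b ∈ Algebra.adjoin L s := hs ▸ Algebra.mem_top
    induction hb using Algebra.adjoin_induction with
    | mem x hx => exact h x hx
    | algebraMap c => rw [← IsScalarTower.algebraMap_apply, D.map_algebraMap]
    | add x y _ _ hx hy => rw [map_add, map_add, hx, hy, add_zero]
    | mul x y _ _ hx hy => rw [map_mul, D.leibniz, hx, hy, smul_zero, smul_zero, add_zero]
  obtain ⟨a, b, -, rfl⟩ := IsFractionRing.div_surjective (A := B) x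
  rw [D.leibniz_div, hB, hB, smul_zero, smul_zero, sub_zero, smul_zero]

/-- The coordinates generate the quotient domain, so its fraction field has no nonzero
`L`-derivation and is finite over `L`. A domain integral over a field is a field. -/
theorem Ideal.isMaximal_of_derivation_eq_zero {σ : Type*} [Finite σ]
    {p : Ideal (MvPolynomial σ L)} [p.IsPrime]
    (h : ∀ (D : Derivation L (FractionRing (MvPolynomial σ L ⧸ p))
        (FractionRing (MvPolynomial σ L ⧸ p))) (k : σ),
      D (algebraMap (MvPolynomial σ L ⧸ p) _ (Ideal.Quotient.mk p (MvPolynomial.X k))) = 0) :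
    p.IsMaximal := by
  set B := MvPolynomial σ L ⧸ p
  have hadj : Algebra.adjoin L (Set.range fun k : σ => (Ideal.Quotient.mk p (MvPolynomial.X k) : B))
      = ⊤ := by
    have h1 : (Set.range fun k : σ => (Ideal.Quotient.mk p (MvPolynomial.X k) : B)) =
        Ideal.Quotient.mkₐ L p '' Set.range MvPolynomial.X := by
      rw [← Set.range_comp]
      rfl
    rw [h1, ← AlgHom.map_adjoin, MvPolynomial.adjoin_range_X, Algebra.map_top,
      AlgHom.range_eq_top]
    exact Ideal.Quotient.mkₐ_surjective L p
  have hess : Algebra.EssFiniteType L (FractionRing B) := by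
    have : Algebra.EssFiniteType B (FractionRing B) :=
      Algebra.EssFiniteType.of_isLocalization _ (nonZeroDivisors B)
    exact Algebra.EssFiniteType.comp L B (FractionRing B)
  have hfin : Module.Finite L (FractionRing B) :=
    Module.finite_of_derivation_eq_zero fun D =>
      Derivation.eq_zero_of_fractionRing hadj D (by rintro _ ⟨k, rfl⟩; exact h D k)
  have hint : Algebra.IsIntegral L B :=
    ⟨fun b => (isIntegral_algebraMap_iff (IsFractionRing.injective B (FractionRing B))).1
      (Algebra.IsIntegral.isIntegral (R := L) (algebraMap B (FractionRing B) b))⟩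
  exact Ideal.Quotient.maximal_of_isField p
    (isField_of_isIntegral_of_isField' (Field.toIsField L))

end FunctionFields

/-! ### Regularity as nonvanishing of a resultant. -/

section Regularity

variable {K M : Type*} [Field K] [Field M] [CharZero M] [Algebra K M]
  {n m : ℕ} {lam : ℕ → K} {f : M} {C : LaurentSeries M} {P Q : M[X]}

theorem IsSolutionWithPair.natDegree_right (h : IsSolutionWithPair n m lam f C P Q) (hn : 2 ≤ n)
    (hlam : lam 0 = 1) : Q.natDegree = m := by
  obtain ⟨F, hF, -, hQ⟩ := h.eq_sum
  have h1 : Q.coeff m = 1 := by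
    rw [← xCoeff_polyToLaurent_natCast, hQ, xCoeff_add, hF _ (by omega), add_zero, xCoeff_sum,
      Finset.sum_eq_single 0]
    · rw [hlam, map_one, xCoeff_smul, one_mul, Nat.cast_zero, sub_zero,
        h.normalized.xCoeff_laurentZPow]
    · intro i _ hi
      rw [xCoeff_smul, h.normalized.hasDegLE_laurentZPow _ _ (by omega), mul_zero]
    · intro h0
      rw [Finset.mem_range] at h0
      omega
  refine natDegree_eq_of_le_of_coeff_ne_zero ?_ (h1 ▸ one_ne_zero)
  rw [← hasDegLE_polyToLaurent_iff, hQ]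
  exact (h.normalized.hasDegLE_lamSum n m lam).add (HasDegLE.mono (a := 1 - n) hF (by omega))

/-- The derivatives of the pair are coprime if and only if their resultant does not vanish. -/
theorem IsSolutionWithPair.isCoprime_iff (h : IsSolutionWithPair n m lam f C P Q) (hn : 2 ≤ n)
    (hlam : lam 0 = 1) : IsCoprime (derivative P) (derivative Q) ↔
      resultant (derivative P) (derivative Q) (n - 1) (m - 1) ≠ 0 := by
  have h1 : (derivative P).natDegree = n - 1 := h.natDegree_derivative
  have h2 : (derivative Q).natDegree = m - 1 := by
    rw [Polynomial.natDegree_derivative, h.natDegree_right hn hlam]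
  have h3 : derivative P ≠ 0 := by
    intro h0
    rw [h0, natDegree_zero] at h1
    omega
  have h4 := resultant_eq_zero_iff (f := derivative P) (g := derivative Q)
  rw [h1, h2] at h4
  rw [ne_eq, h4]
  simp [h3]

end Regularity

/-! ### Isolated points of the standard system. -/

section Core

variable {K L : Type*} [Field K] [Field L] [Algebra K L]
  {n m : ℕ} {lam : ℕ → K} {f : L}

/-- The ideal generated by the standard system. -/
abbrev systemIdeal (n m : ℕ) (lam : ℕ → K) (f : L) :
    Ideal (MvPolynomial (Fin (m + n - 2)) L) :=
  Ideal.span (Set.range (standardSystem n m lam f))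

theorem systemIdeal_le_ker_iff {R : Type*} [CommRing R] [Algebra L R] [Algebra K R]
    [IsScalarTower K L R] (hn : 2 ≤ n) (hm : 2 ≤ m)
    (ψ : MvPolynomial (Fin (m + n - 2)) L →ₐ[L] R) :
    systemIdeal n m lam f ≤ RingHom.ker ψ ↔
      IsSystemZero n m lam (algebraMap L R f) (fun k => ψ (MvPolynomial.X k)) := by
  rw [← map_standardSystem_eq_zero_iff hn hm, Ideal.span_le, Set.range_subset_iff]
  rfl

theorem exists_isPrimitiveRoot_of_isAlgClosed (L : Type*) [Field L] [CharZero L] [IsAlgClosed L]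
    {n : ℕ} (hn : n ≠ 0) : ∃ ζ : L, IsPrimitiveRoot ζ n := by
  have : NeZero (n : L) := ⟨Nat.cast_ne_zero.2 hn⟩
  exact HasEnoughRootsOfUnity.exists_primitiveRoot L n

/-- The point of affine space attached to a series. -/
def pointOf (N : ℕ) (C : LaurentSeries L) (k : Fin N) : L := xCoeff C (-((k : ℤ) + 1))

/-- The maximal ideal of polynomials vanishing at the point attached to a series. -/
def idealOf (N : ℕ) (C : LaurentSeries L) : Ideal (MvPolynomial (Fin N) L) :=
  RingHom.ker (MvPolynomial.aeval (pointOf N C) : MvPolynomial (Fin N) L →ₐ[L] L)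

theorem idealOf_isMaximal (N : ℕ) (C : LaurentSeries L) : (idealOf N C).IsMaximal :=
  RingHom.ker_isMaximal_of_surjective _ fun c =>
    ⟨MvPolynomial.C c, by simp⟩

theorem pointOf_eq_of_idealOf_eq {N : ℕ} {C C' : LaurentSeries L} (h : idealOf N C = idealOf N C') :
    pointOf N C = pointOf N C' := by
  ext k
  have h1 : MvPolynomial.X k - MvPolynomial.C (pointOf N C k) ∈ idealOf N C := by
    rw [idealOf, RingHom.mem_ker]
    simp
  rw [h, idealOf, RingHom.mem_ker] at h1
  simpa [sub_eq_zero, eq_comm] using h1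

theorem IsSolution.systemIdeal_le (hn : 2 ≤ n) (hm : 2 ≤ m) {C : LaurentSeries L}
    (h : IsSolution n m lam f C) : systemIdeal n m lam f ≤ idealOf (m + n - 2) C := by
  rw [idealOf, systemIdeal_le_ker_iff hn hm]
  simpa [pointOf] using h.isSystemZero hn hm

/-- A prime ideal of the standard system contained in the maximal ideal of a solution is equal to
it, if the solution is regular or if `f ≠ 0`. -/
theorem IsSolution.isMaximal_of_le [CharZero L] [IsAlgClosed L] (hn : 2 ≤ n) (hm : 2 ≤ m) (hlam : lam 0 = 1)
    {C : LaurentSeries L} (hC : f ≠ 0 ∨ IsRegularSolution n m lam f C)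
    {p : Ideal (MvPolynomial (Fin (m + n - 2)) L)} [p.IsPrime]
    (hp : systemIdeal n m lam f ≤ p) (hpC : p ≤ idealOf (m + n - 2) C) : p.IsMaximal := by
  set B := MvPolynomial (Fin (m + n - 2)) L ⧸ p with hB
  set M := FractionRing B with hM
  have : IsScalarTower K L B := inferInstance
  have : IsScalarTower K B M := inferInstance
  have : IsScalarTower L B M := inferInstance
  have : IsScalarTower K L M := inferInstance
  have : CharZero M := charZero_of_injective_algebraMap (algebraMap L M).injective
  set zB : Fin (m + n - 2) → B := fun k => Ideal.Quotient.mk p (MvPolynomial.X k) with hzB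
  set PB := polyPart n (truncSeries zB ^ n) with hPB
  set QB := polyPart m (lamSum n m lam (truncSeries zB)) with hQB
  -- `PB` and `QB` form the universal pair over `B`: it specializes to the pair of `C` and extends
  -- to the pair of the generic point.
  have hmap : ∀ {R : Type _} [CommRing R] [Algebra K R] (φ : B →ₐ[K] R),
      polyPart n (truncSeries (φ ∘ zB) ^ n) = PB.map (φ : B →+* R) ∧
      polyPart m (lamSum n m lam (truncSeries (φ ∘ zB))) = QB.map (φ : B →+* R) := by
    intro R _ _ φ
    have e := laurentMap_truncSeries (φ : B →+* R) zB
    rw [hPB, hQB, ← polyPart_laurentMap, ← polyPart_laurentMap, map_pow,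
      laurentMap_lamSum φ n m lam (truncSeries_isNormalized zB), e]
    exact ⟨rfl, rfl⟩
  have hzero : IsSystemZero n m lam (algebraMap L M f) (algebraMap B M ∘ zB) := by
    have hle : systemIdeal n m lam f ≤
        RingHom.ker ((IsScalarTower.toAlgHom L B M).comp (Ideal.Quotient.mkₐ L p)) := by
      refine hp.trans fun x hx => ?_
      have : Ideal.Quotient.mk p x = 0 := Ideal.Quotient.eq_zero_iff_mem.2 hx
      change algebraMap B M (Ideal.Quotient.mk p x) = 0
      rw [this, map_zero]
    exact (systemIdeal_le_ker_iff hn hm _).1 hle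
  obtain ⟨C', hC'z, hC'⟩ := hzero.exists_isSolutionWithPair hn hm
  have hmapM := hmap (IsScalarTower.toAlgHom K B M)
  apply Ideal.isMaximal_of_derivation_eq_zero
  intro D k
  set δ := D.toInt with hδ
  have hδL : ∀ a : L, δ (algebraMap L M a) = 0 := fun a => D.map_algebraMap a
  have hδK : ∀ a : K, δ (algebraMap K M a) = 0 := fun a => by
    rw [IsScalarTower.algebraMap_apply K L M, hδL]
  have hzero : polyDeriv δ (polyPart n (truncSeries (algebraMap B M ∘ zB) ^ n)) = 0 := by
    rcases hC with hf | ⟨P, Q, hPQ, U, V, hUV⟩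
    · obtain ⟨ζ, hζ⟩ := exists_isPrimitiveRoot_of_isAlgClosed L (n := n) (by omega)
      refine hC'.polyDeriv_eq_zero_of_ne_zero hn δ hδK (hδL f) ?_
        (hζ.map_of_injective (algebraMap L M).injective)
      rwa [Ne, map_eq_zero_iff _ (algebraMap L M).injective]
    · refine hC'.polyDeriv_eq_zero_of_isCoprime hn δ hδK (hδL f) ?_
      have hres := (hPQ.isCoprime_iff hn hlam).1 ⟨U, V, hUV⟩
      let φ : B →ₐ[L] L := Ideal.Quotient.liftₐ p
        (MvPolynomial.aeval (pointOf (m + n - 2) C)) fun a ha => hpC ha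
      have hφz : φ ∘ zB = pointOf (m + n - 2) C := by
        ext k
        exact MvPolynomial.aeval_X _ _
      have hmapL := hmap (φ.restrictScalars K)
      have hpair := hPQ.eq_polyPart hn hm (z := pointOf (m + n - 2) C) fun _ => rfl
      have hφz' : (φ.restrictScalars K : B → L) ∘ zB = pointOf (m + n - 2) C := hφz
      rw [hφz'] at hmapL
      rw [hpair.1, hpair.2, hmapL.1, hmapL.2, derivative_map, derivative_map,
        resultant_map_map] at hres
      -- With formal degrees fixed, the resultant commutes with ring maps. It is nonzero at the
      -- point, hence nonzero in `B` and in its fraction field `M`.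
      have hres' : resultant (derivative PB) (derivative QB) (n - 1) (m - 1) ≠ 0 := by
        rintro h0
        rw [h0, map_zero] at hres
        exact hres rfl
      refine (hC'.isCoprime_iff hn hlam).2 ?_
      have e1 : polyPart n (truncSeries (algebraMap B M ∘ zB) ^ n) =
        PB.map (algebraMap B M) := hmapM.1
      have e2 : polyPart m (lamSum n m lam (truncSeries (algebraMap B M ∘ zB))) =
        QB.map (algebraMap B M) := hmapM.2
      rw [e1, e2, derivative_map, derivative_map, resultant_map_map]
      rwa [Ne, map_eq_zero_iff _ (IsFractionRing.injective B M)]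
  have hk := hC'.derivation_eq_zero hn δ hzero (-((k : ℤ) + 1))
  rwa [hC'z] at hk

theorem IsSolution.eq_of_le [CharZero L] [IsAlgClosed L] (hn : 2 ≤ n) (hm : 2 ≤ m) (hlam : lam 0 = 1)
    {C : LaurentSeries L} (hC : f ≠ 0 ∨ IsRegularSolution n m lam f C)
    {p : Ideal (MvPolynomial (Fin (m + n - 2)) L)} (hpp : p.IsPrime)
    (hp : systemIdeal n m lam f ≤ p) (hpC : p ≤ idealOf (m + n - 2) C) :
    p = idealOf (m + n - 2) C :=
  (IsSolution.isMaximal_of_le hn hm hlam hC hp hpC).eq_of_le (idealOf_isMaximal _ C).ne_top hpC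

/-- The solutions which are regular, or all solutions if `f ≠ 0`, are finite in number. -/
theorem finite_setOf_isSolution [CharZero L] [IsAlgClosed L] (hn : 2 ≤ n) (hm : 2 ≤ m) (hlam : lam 0 = 1) :
    {C : LaurentSeries L | IsSolution n m lam f C ∧
      (f ≠ 0 ∨ IsRegularSolution n m lam f C)}.Finite := by
  -- Isolated points are minimal primes of the system, of which a Noetherian ring has finitely many.
  refine Set.Finite.of_injOn (f := idealOf (m + n - 2)) (t := (systemIdeal n m lam f).minimalPrimes)
    ?_ ?_ (Ideal.finite_minimalPrimes_of_isNoetherianRing _ _)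
  · rintro C ⟨h, hC⟩
    refine ⟨⟨(idealOf_isMaximal _ C).isPrime, h.systemIdeal_le hn hm⟩, ?_⟩
    rintro p ⟨hpp, hp⟩ hpC
    exact (IsSolution.eq_of_le hn hm hlam hC hpp hp hpC).ge
  · rintro C ⟨h, -⟩ C' ⟨h', -⟩ heq
    have hu : IsUnit (n : L) := IsUnit.mk0 _ (Nat.cast_ne_zero.2 (by omega))
    exact h.eq_of_xCoeff_eq hn hm hu h' fun k => congrFun (pointOf_eq_of_idealOf_eq heq) k

/-- Every prime of the quotient lies below a maximal ideal, which by the Nullstellensatz is a point,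
hence a solution. Such a prime equals the ideal of that point, so all primes are maximal. The zero
ring is allowed. -/
theorem standardSystemDim_le_zero [CharZero L] [IsAlgClosed L] (hn : 2 ≤ n) (hm : 2 ≤ m) (hlam : lam 0 = 1)
    (hC : ∀ C : LaurentSeries L, IsSolution n m lam f C →
      f ≠ 0 ∨ IsRegularSolution n m lam f C) : standardSystemDim n m lam f ≤ 0 := by
  rw [standardSystemDim, ← Nat.cast_zero, ← Ring.krullDimLE_iff, Ring.krullDimLE_zero_iff]
  intro J hJ
  set π := Ideal.Quotient.mk (systemIdeal n m lam f)
  have hπ : Function.Surjective π := Ideal.Quotient.mk_surjective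
  have hker : RingHom.ker π = systemIdeal n m lam f := Ideal.mk_ker
  have hle : RingHom.ker π ≤ J.comap π := Ideal.comap_mono bot_le
  obtain ⟨q, hq, hJq⟩ := Ideal.exists_le_maximal (J.comap π) (Ideal.IsPrime.comap π).ne_top
  obtain ⟨z, hz⟩ := MvPolynomial.isMaximal_iff_eq_vanishingIdeal_singleton.1 hq
  have hqz : q = RingHom.ker (MvPolynomial.aeval z : MvPolynomial (Fin (m + n - 2)) L →ₐ[L] L) := by
    ext a
    rw [hz, MvPolynomial.mem_vanishingIdeal_singleton_iff, RingHom.mem_ker]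
  have hI : systemIdeal n m lam f ≤ RingHom.ker
      (MvPolynomial.aeval z : MvPolynomial (Fin (m + n - 2)) L →ₐ[L] L) := by
    rw [← hqz, ← hker]
    exact hle.trans hJq
  rw [systemIdeal_le_ker_iff hn hm] at hI
  obtain ⟨C, hCz, hsol⟩ := hI.exists_isSolutionWithPair hn hm
  have hqC : q = idealOf (m + n - 2) C := by
    rw [hqz, idealOf]
    congr
    ext k
    rw [pointOf, hCz]
    simp
  have heq := IsSolution.eq_of_le hn hm hlam (hC C ⟨_, _, hsol⟩) (Ideal.IsPrime.comap π)
    (hker ▸ hle) (hqC ▸ hJq)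
  have hmax : (J.comap π).IsMaximal := heq ▸ idealOf_isMaximal _ C
  rw [← Ideal.map_comap_of_surjective π hπ J]
  exact Ideal.IsMaximal.map_of_surjective_of_ker_le hπ hle

theorem IsSolution.standardSystemDim_nonneg (hn : 2 ≤ n) (hm : 2 ≤ m) {C : LaurentSeries L}
    (h : IsSolution n m lam f C) : 0 ≤ standardSystemDim n m lam f := by
  have hne : systemIdeal n m lam f ≠ ⊤ := fun htop =>
    (idealOf_isMaximal (m + n - 2) C).ne_top (top_le_iff.1 (htop ▸ h.systemIdeal_le hn hm))
  have : Nontrivial (MvPolynomial (Fin (m + n - 2)) L ⧸ systemIdeal n m lam f) :=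
    Ideal.Quotient.nontrivial_iff.2 hne
  exact ringKrullDim_nonneg_of_nontrivial

end Core

/-! ### Passage from `D` to the algebraic closure, and the theorem. -/

section Descent

variable {K D L : Type*} [Field K] [CommRing D] [Field L] [Algebra K D] [Algebra K L] [Algebra D L]
  [IsScalarTower K D L] {n m : ℕ} {lam : ℕ → K} {f : D}

theorem IsSolution.mapAlgebra {C : LaurentSeries D} (h : IsSolution n m lam f C) :
    IsSolution n m lam (algebraMap D L f) (laurentMap (algebraMap D L) C) :=
  h.map (IsScalarTower.toAlgHom K D L)

theorem IsRegularSolution.mapAlgebra {C : LaurentSeries D} (h : IsRegularSolution n m lam f C) :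
    IsRegularSolution n m lam (algebraMap D L f) (laurentMap (algebraMap D L) C) :=
  h.map (IsScalarTower.toAlgHom K D L)

theorem IsRegularSolution.isSolution {C : LaurentSeries D} (h : IsRegularSolution n m lam f C) :
    IsSolution n m lam f C := by
  obtain ⟨P, Q, h, -⟩ := h
  exact ⟨P, Q, h⟩

end Descent
end

theorem mainTheorem4 {K : Type*} [Field K] [CharZero K]
    {D : Type*} [CommRing D] [IsDomain D] [Algebra K D]
    (n m : ℕ) (hnm : ¬ n ∣ m) (hmn : ¬ m ∣ n)
    (lam : ℕ → K) (hlam : lam 0 = 1) (f : D) :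
    -- only finitely many solutions satisfy the Bezout condition, over `D` and over the closure
    {C : LaurentSeries D | IsRegularSolution n m lam f C}.Finite ∧
    {C : LaurentSeries (FracClosure D) |
      IsRegularSolution n m lam (algebraMap D (FracClosure D) f) C}.Finite ∧
    -- finiteness of all solutions, and dimension zero
    ((∃ C : LaurentSeries D, IsRegularSolution n m lam f C) →
      (f ≠ 0 ∨ ∀ C : LaurentSeries (FracClosure D),
        IsSolution n m lam (algebraMap D (FracClosure D) f) C →
          IsRegularSolution n m lam (algebraMap D (FracClosure D) f) C) →
      {C : LaurentSeries D | IsSolution n m lam f C}.Finite ∧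
      {C : LaurentSeries (FracClosure D) |
        IsSolution n m lam (algebraMap D (FracClosure D) f) C}.Finite ∧
      standardSystemDim n m lam (algebraMap D (FracClosure D) f) = 0) ∧
    -- the case `D = K[y]`, `F₁₋ₙ = y` of the systems attached to Jacobian counterexamples
    ({C : LaurentSeries (FracClosure K[X]) |
        IsSolution n m lam (algebraMap K[X] (FracClosure K[X]) X) C}.Finite ∧
      standardSystemDim n m lam (algebraMap K[X] (FracClosure K[X]) X) ≤ 0 ∧
      ((∃ C : LaurentSeries K[X], IsSolution n m lam (X : K[X]) C) →
        standardSystemDim n m lam (algebraMap K[X] (FracClosure K[X]) X) = 0)) := by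
  have hn : 2 ≤ n := by
    rcases n with _ | _ | n
    · exact absurd (dvd_zero m) hmn
    · exact absurd (one_dvd m) hnm
    · omega
  have hm : 2 ≤ m := by
    rcases m with _ | _ | m
    · exact absurd (dvd_zero n) hnm
    · exact absurd (one_dvd n) hmn
    · omega
  have hcD : CharZero (FracClosure D) :=
    charZero_of_injective_algebraMap (algebraMap K (FracClosure D)).injective
  have hcX : CharZero (FracClosure K[X]) :=
    charZero_of_injective_algebraMap (algebraMap K (FracClosure K[X])).injective
  have hinj : Function.Injective (algebraMap D (FracClosure D)) := by
    rw [IsScalarTower.algebraMap_eq D (FractionRing D) (FracClosure D)]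
    exact (algebraMap (FractionRing D) (FracClosure D)).injective.comp
      (IsFractionRing.injective D (FractionRing D))
  have hinjX : Function.Injective (algebraMap K[X] (FracClosure K[X])) := by
    rw [IsScalarTower.algebraMap_eq K[X] (FractionRing K[X]) (FracClosure K[X])]
    exact (algebraMap (FractionRing K[X]) (FracClosure K[X])).injective.comp
      (IsFractionRing.injective K[X] (FractionRing K[X]))
  have hreg : {C : LaurentSeries (FracClosure D) |
      IsRegularSolution n m lam (algebraMap D (FracClosure D) f) C}.Finite :=
    (finite_setOf_isSolution hn hm hlam).subset fun C hC => ⟨hC.isSolution, Or.inr hC⟩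
  refine ⟨?_, hreg, ?_, ?_⟩
  -- Solutions over `D` inject into those over the closure, coefficient by coefficient.
  · exact Set.Finite.of_injOn (f := laurentMap (algebraMap D (FracClosure D)))
      (fun C hC => IsRegularSolution.mapAlgebra hC) (laurentMap_injective hinj).injOn hreg
  · rintro ⟨C₀, hC₀⟩ hgood
    have hgood' : ∀ C : LaurentSeries (FracClosure D),
        IsSolution n m lam (algebraMap D (FracClosure D) f) C →
        algebraMap D (FracClosure D) f ≠ 0 ∨
          IsRegularSolution n m lam (algebraMap D (FracClosure D) f) C := fun C hC =>
      hgood.imp (fun h0 => (map_ne_zero_iff _ hinj).2 h0) fun h => h C hC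
    have hfin : {C : LaurentSeries (FracClosure D) |
        IsSolution n m lam (algebraMap D (FracClosure D) f) C}.Finite :=
      (finite_setOf_isSolution hn hm hlam).subset fun C hC => ⟨hC, hgood' C hC⟩
    refine ⟨?_, hfin, ?_⟩
    · exact Set.Finite.of_injOn (f := laurentMap (algebraMap D (FracClosure D)))
        (fun C hC => IsSolution.mapAlgebra hC) (laurentMap_injective hinj).injOn hfin
    · exact le_antisymm (standardSystemDim_le_zero hn hm hlam hgood')
        (hC₀.isSolution.mapAlgebra.standardSystemDim_nonneg hn hm)
  · have hX0 : algebraMap K[X] (FracClosure K[X]) X ≠ 0 := (map_ne_zero_iff _ hinjX).2 X_ne_zero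
    have hle := standardSystemDim_le_zero hn hm hlam (f := algebraMap K[X] (FracClosure K[X]) X)
      fun _ _ => Or.inl hX0
    refine ⟨(finite_setOf_isSolution hn hm hlam).subset fun C hC => ⟨hC, Or.inl hX0⟩, hle, ?_⟩
    rintro ⟨C₀, hC₀⟩
    exact le_antisymm hle (hC₀.mapAlgebra.standardSystemDim_nonneg hn hm)
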